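/- **Setting.** Let $L_2=L_2([0,1])$ be the real Hilbert space with inner product $\langle\cdot,\cdot\rangle$, norm $\|\cdot\|$ and Borel $\sigma$-algebra, $x\in L_2$, $(\varphi_j)_{j\ge1}$ an orthonormal basis of $L_2$, and $\mathcal N=\{y:\|y-x\|<\delta\}$ with $\delta>0$. Let $n,J,K\ge1$ be integers. One observes i.i.d. pairs $(X_j,Y_j)$, $j=1,\dots,n$, with $X_j\in L_2$ and $Y_j=g(X_j)+\varepsilon_j$, where $g:L_2\to\mathbb R$ is measurable, $E(\varepsilon_j\mid X_j)=0$ and $\operatorname{Var}(\varepsilon_j\mid X_j)\le\sigma^2$ almost surely, with a deterministic $\sigma>0$. Put $\mathcal K=\{\mathbf k\in\mathbb N_0^J:\ |\mathbf k|=k_1+\dots+k_J\le K-1\}$ and $\xi_{j;\mathbf k}=\prod_{l=1}^J\langle X_j-x,\varphi_l\rangle^{k_l}$, and define $$\mathcal M=\Big(\sum_{j=1}^n 1_{\mathcal N}(X_j)\,\xi_{j;\mathbf k}\,\xi_{j;\mathbf k'}\Big)_{\mathbf k,\mathbf k'\in\mathcal K},\qquad \mathcal Y=\Big(\sum_{j=1}^n1_{\mathcal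 N}(X_j)\,\xi_{j;\mathbf k}\,Y_j\Big)_{\mathbf k\in\mathcal K},$$ and let $\mathcal S$ be the diagonal matrix with entries $1/\binom{|\mathbf k|}{k_1,\dots,k_J}$. The Tikhonov-regularised functional local polynomial estimator is $\hat g(x)=\mathbf e_0^\dagger(\mathcal M+\mathcal S)^{-1}\mathcal Y$, where $\mathbf e_0$ is the unit vector that belongs to $\mathbf k=0$. Let $\Gamma_{\mathcal N}=E\big((X_1-x)\otimes(X_1-x)\mid X_1\in\mathcal N\big)$. Write $g^{(k)}(y)$ for the $k$th Fréchet derivative at $y$ (a $k$-linear form) and $\|g^{(k)}(y)\|$ for its norm, the supremum of its absolute value over unit vectors. **Density condition** (with constants $c_1,c_2>0$). Let $\|\cdot\|_\lambda$ be some norm on $\mathbb R^J$, $V=(\langle X_1-x,\varphi_l\rangle)_{l\le J}$, $T=V/\|V\|_\lambda$ (with $T=0$ if $V=0$), and $\Phi=P[X_1\in\mathcal N\mid T]$. On $\{\Phi>0\}$ the random probability measure $A\mapsto P[X_1\in\mathcal N,\ \|V\|_\lambda\in A\mid T]/\Phi$ has a Lebesgue density $p(\cdot\,;T)$, and $$P\Big[X_1\in\mathcal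 N,\ \sup_{t>0}t\,p(t;T)\le c_1J\Big]\ \ge\ P[X_1\in\mathcal N]/c_2 .$$ **Theorem 1.** Let $c_1,c_2,c_3>0$ and $\delta_0<1$ be constants. For every $\eta>0$ there is a constant $C>0$, depending only on $\eta,c_1,c_2,c_3,\delta_0$, with the following property. In the setting above, with any $n,J,K\ge1$, any $0<\delta\le\delta_0$, any $x$, $(\varphi_j)_j$, $\sigma$ and any distribution of the data, assume that the density condition holds for some norm $\|\cdot\|_\lambda$ on $\mathbb R^J$, that $g$ is $\beta$-fold Fréchet differentiable on $\mathcal N$ for some integer $0\le\beta\le K$, and that $$\sum_{k=1}^{\beta-1}\frac{\delta^{k-1}}{(k-1)!}\,\|g^{(k)}(x)\|\le c_3 .$$ Then $$P\big[\,|\hat g(x)-g(x)|^2> C\,R\,\big]\le\eta,$$ where $$R=e^{8c_1(K-1)}J^{(8c_1+2)(K-1)}\left\{\frac{\sigma^2+\sum_{k=0}^{\beta-1}\frac{J^k}{k!^2}\|g^{(k)}(x)\|^2}{n\,P[X_1\in\mathcal N]}+\frac{\delta^{2\beta}}{\beta!^2}\sup_{y\in\mathcal N}\|g^{(\beta)}(y)\|^2+\sum_{j>J}\langle\varphi_j,\Gamma_{\mathcal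 N}\varphi_j\rangle\right\}$$ (read as $\infty$ if $P[X_1\in\mathcal N]=0$ or if the supremum is infinite). That is, $|\hat g(x)-g(x)|^2=\mathcal O_P(R)$ uniformly with respect to $g$. -/

import Mathlib

open MeasureTheory ProbabilityTheory
open scoped ENNReal

noncomputable section

namespace FLP

/-- The real Hilbert space `L₂([0,1])`. -/
abbrev L2 : Type := Lp ℝ 2 (volume.restrict (Set.Icc (0 : ℝ) 1))

instance instMeasurableSpaceL2 : MeasurableSpace L2 := borel L2

instance instBorelSpaceL2 : BorelSpace L2 := ⟨rfl⟩

/-- The multi-indices `k ∈ ℕ₀^J` with `k₁ + ⋯ + k_J ≤ K - 1` (that is, `< K`). -/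
def multiIdx (J K : ℕ) : Finset (Fin J → ℕ) :=
  (Fintype.piFinset fun _ => Finset.range K).filter fun k => ∑ l, k l < K

/-- The bound on the entries in `multiIdx` is implied by the bound on the sum. -/
theorem mem_multiIdx {J K : ℕ} (k : Fin J → ℕ) : k ∈ multiIdx J K ↔ ∑ l, k l < K := by
  simp only [multiIdx, Finset.mem_filter, Fintype.mem_piFinset, Finset.mem_range,
    and_iff_right_iff_imp]
  intro h l
  exact lt_of_le_of_lt (Finset.single_le_sum (fun i _ => Nat.zero_le (k i)) (Finset.mem_univ l)) h

/-- The first `J` coordinates of `y - x` in the orthonormal basis `φ`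
(the basis is indexed from `0`, so `φ_1, …, φ_J` are `φ 0, …, φ (J - 1)`). -/
def coords (φ : HilbertBasis ℕ ℝ L2) (x : L2) (J : ℕ) (y : L2) : Fin J → ℝ :=
  fun l => inner ℝ (y - x) (φ l)

/-- The monomial `ξ_k = ∏_l ⟨y - x, φ_l⟩ ^ k_l`. -/
def xi (φ : HilbertBasis ℕ ℝ L2) (x : L2) {J : ℕ} (k : Fin J → ℕ) (y : L2) : ℝ :=
  ∏ l, coords φ x J y l ^ k l

/-- The indicator function of the ball `N(x, δ)`. -/
def indN (x : L2) (δ : ℝ) (y : L2) : ℝ :=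
  (Metric.ball x δ).indicator (fun _ => (1 : ℝ)) y

/-- The Gram matrix `M` of the local monomials. -/
def gramMatrix (φ : HilbertBasis ℕ ℝ L2) (x : L2) (δ : ℝ) (J K : ℕ) {n : ℕ} (X : Fin n → L2) :
    Matrix (multiIdx J K) (multiIdx J K) ℝ :=
  Matrix.of fun k k' => ∑ j, indN x δ (X j) * xi φ x k.1 (X j) * xi φ x k'.1 (X j)

/-- The right-hand side of the normal equations. -/
def momentVec (φ : HilbertBasis ℕ ℝ L2) (x : L2) (δ : ℝ) (J K : ℕ) {n : ℕ}
    (X : Fin n → L2) (Y : Fin n → ℝ) : multiIdx J K → ℝ :=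
  fun k => ∑ j, indN x δ (X j) * xi φ x k.1 (X j) * Y j

/-- The Tikhonov matrix: diagonal, with the inverse multinomial coefficients as entries. -/
def tikhonov (J K : ℕ) : Matrix (multiIdx J K) (multiIdx J K) ℝ :=
  Matrix.diagonal fun k => 1 / (Nat.multinomial Finset.univ k.1 : ℝ)

/-- The unit vector that belongs to the multi-index `0`. -/
def e0 (J K : ℕ) : multiIdx J K → ℝ := fun k => if k.1 = 0 then 1 else 0

/-- The Tikhonov-regularised functional local polynomial estimator of `g x`. -/
def estimator (φ : HilbertBasis ℕ ℝ L2) (x : L2) (δ : ℝ) (J K : ℕ) {n : ℕ}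
    (X : Fin n → L2) (Y : Fin n → ℝ) : ℝ :=
  e0 J K ⬝ᵥ
    (Matrix.mulVec (gramMatrix φ x δ J K X + tikhonov J K)⁻¹ (momentVec φ x δ J K X Y))

/-- I.i.d. data `(X_j, Y_j)`, `j = 1, …, n`, with `Y_j = g(X_j) + ε_j`, where `ε_j` is
conditionally centred given `X_j`, with conditional variance given `X_j` at most `σ²`. -/
structure IsRegressionSample {Ω : Type*} [MeasurableSpace Ω] (μ : Measure Ω) {n : ℕ}
    (X : Fin n → Ω → L2) (Y : Fin n → Ω → ℝ) (g : L2 → ℝ) (σ : ℝ) : Prop where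
  measurable_X : ∀ j, Measurable (X j)
  measurable_Y : ∀ j, Measurable (Y j)
  measurable_g : Measurable g
  indep : iIndepFun (fun j ω => (X j ω, Y j ω)) μ
  identDistrib : ∀ i j,
    IdentDistrib (fun ω => (X i ω, Y i ω)) (fun ω => (X j ω, Y j ω)) μ μ
  error_memLp : ∀ j, MemLp (fun ω => Y j ω - g (X j ω)) 2 μ
  error_centered : ∀ j,
    μ[fun ω => Y j ω - g (X j ω) | MeasurableSpace.comap (X j) inferInstance] =ᵐ[μ] 0
  error_condVar : ∀ j,
    μ[fun ω => (Y j ω - g (X j ω)) ^ 2 | MeasurableSpace.comap (X j) inferInstance]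
      ≤ᵐ[μ] fun _ => σ ^ 2

/-- `g` is `β`-fold Fréchet differentiable on the ball `N(x, δ)`
(no continuity of the highest derivative is required). -/
def FrechetDiffOnBall (g : L2 → ℝ) (x : L2) (δ : ℝ) (β : ℕ) : Prop :=
  ∀ k < β, ∀ y ∈ Metric.ball x δ, DifferentiableAt ℝ (iteratedFDeriv ℝ k g) y

/-- The direction `v / q v` of a vector `v`. -/
def direction {J : ℕ} (q : Seminorm ℝ (Fin J → ℝ)) (v : Fin J → ℝ) : Fin J → ℝ :=
  (q v)⁻¹ • v

/-- The conditional probability `P[E | T]` of an event given a random vector `T`. -/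
def condProbGiven {Ω : Type*} [MeasurableSpace Ω] (μ : Measure Ω) {J : ℕ} (E : Set Ω)
    (T : Ω → Fin J → ℝ) : Ω → ℝ :=
  μ[E.indicator (fun _ => (1 : ℝ)) | MeasurableSpace.comap T inferInstance]

/-- Let `V` be the vector of the first `J` coordinates of `Z - x`, `T = V / q V` its direction and
`Φ = P[Z ∈ N | T]`. On `{Φ > 0}`, the random probability measure
`A ↦ P[Z ∈ N, q V ∈ A | T] / Φ` has the Lebesgue density `p(T, ·)`. -/
def HasRadialDensity {Ω : Type*} [MeasurableSpace Ω] (μ : Measure Ω) (Z : Ω → L2)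
    (φ : HilbertBasis ℕ ℝ L2) (x : L2) (δ : ℝ) {J : ℕ} (q : Seminorm ℝ (Fin J → ℝ))
    (p : (Fin J → ℝ) → ℝ → ℝ) : Prop :=
  Measurable (Function.uncurry p) ∧ (∀ v t, 0 ≤ p v t) ∧
  ∀ A : Set ℝ, MeasurableSet A →
    ∀ᵐ ω ∂μ,
      0 < condProbGiven μ {ω | Z ω ∈ Metric.ball x δ}
        (fun ω => direction q (coords φ x J (Z ω))) ω →
      condProbGiven μ {ω | Z ω ∈ Metric.ball x δ ∧ q (coords φ x J (Z ω)) ∈ A}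
          (fun ω => direction q (coords φ x J (Z ω))) ω /
        condProbGiven μ {ω | Z ω ∈ Metric.ball x δ}
          (fun ω => direction q (coords φ x J (Z ω))) ω
      = ∫ t in A, p (direction q (coords φ x J (Z ω))) t

/-- The density condition: the radial density exists, and with `T` the direction,
`P[Z ∈ N, sup_{t > 0} t p(T, t) ≤ c₁ J] ≥ P[Z ∈ N] / c₂`. -/
def DensityCondition {Ω : Type*} [MeasurableSpace Ω] (μ : Measure Ω) (Z : Ω → L2)
    (φ : HilbertBasis ℕ ℝ L2) (x : L2) (δ : ℝ) {J : ℕ} (q : Seminorm ℝ (Fin J → ℝ))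
    (c₁ c₂ : ℝ) : Prop :=
  ∃ p : (Fin J → ℝ) → ℝ → ℝ, HasRadialDensity μ Z φ x δ q p ∧
    μ {ω | Z ω ∈ Metric.ball x δ} / ENNReal.ofReal c₂ ≤
      μ {ω | Z ω ∈ Metric.ball x δ ∧
        ∀ t : ℝ, 0 < t → t * p (direction q (coords φ x J (Z ω))) t ≤ c₁ * J}

/-- The operator `Γ_N = E[(Z - x) ⊗ (Z - x) | Z ∈ N]` on `L₂([0,1])`. -/
def GammaN {Ω : Type*} [MeasurableSpace Ω] (μ : Measure Ω) (Z : Ω → L2) (x : L2) (δ : ℝ) :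
    L2 →L[ℝ] L2 :=
  ∫ ω, InnerProductSpace.rankOne ℝ (Z ω - x) (Z ω - x) ∂(μ[|{ω | Z ω ∈ Metric.ball x δ}])

/-- The truncation term `∑_{j > J} ⟨φ_j, Γ_N φ_j⟩`. -/
def truncTerm {Ω : Type*} [MeasurableSpace Ω] (μ : Measure Ω) (Z : Ω → L2)
    (φ : HilbertBasis ℕ ℝ L2) (x : L2) (δ : ℝ) (J : ℕ) : ℝ≥0∞ :=
  ∑' i : ℕ, ENNReal.ofReal (inner ℝ (φ (J + i)) (GammaN μ Z x δ (φ (J + i))))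

/-- The variance term
`(σ² + ∑_{k < β} J^k ‖g^{(k)}(x)‖² / k!²) / (n P[Z ∈ N])`; it is `∞` if `P[Z ∈ N] = 0`. -/
def varTerm {Ω : Type*} [MeasurableSpace Ω] (μ : Measure Ω) (Z : Ω → L2)
    (g : L2 → ℝ) (x : L2) (δ σ : ℝ) (n J β : ℕ) : ℝ≥0∞ :=
  ENNReal.ofReal (σ ^ 2 + ∑ k ∈ Finset.range β,
      (J : ℝ) ^ k / (k.factorial : ℝ) ^ 2 * ‖iteratedFDeriv ℝ k g x‖ ^ 2) /
    ((n : ℝ≥0∞) * μ {ω | Z ω ∈ Metric.ball x δ})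

/-- The Taylor term `δ^{2β} sup_{y ∈ N} ‖g^{(β)}(y)‖² / β!²`; it may be `∞`. -/
def taylorTerm (g : L2 → ℝ) (x : L2) (δ : ℝ) (β : ℕ) : ℝ≥0∞ :=
  ENNReal.ofReal (δ ^ (2 * β) / (β.factorial : ℝ) ^ 2) *
    ⨆ y ∈ Metric.ball x δ, ‖iteratedFDeriv ℝ β g y‖ₑ ^ 2

/-- The rate of the estimator. -/
def rate {Ω : Type*} [MeasurableSpace Ω] (μ : Measure Ω) (Z : Ω → L2)
    (φ : HilbertBasis ℕ ℝ L2) (g : L2 → ℝ) (x : L2) (δ σ c₁ : ℝ) (n J K β : ℕ) : ℝ≥0∞ :=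
  ENNReal.ofReal (Real.exp (8 * c₁ * ((K : ℝ) - 1)) *
      (J : ℝ) ^ ((8 * c₁ + 2) * ((K : ℝ) - 1))) *
    (varTerm μ Z g x δ σ n J β + taylorTerm g x δ β + truncTerm μ Z φ x δ J)

end FLP

end

/-! The estimator is a ridge regression on the polynomials of degree `< K` in the first `J`
coordinates, and its error at the centre is governed by the single random number
`a = e₀ ⬝ (M + S)⁻¹ e₀`, the *leverage* of the centre. With `u = (M + S)⁻¹ e₀` and the design
vectors `d_j`, the energy identity `a = ⟨u, S u⟩ + ∑ (d_j ⬝ u)²` shows that the weights `d_j ⬝ u`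
of the responses have sum of squares at most `a`. Hence the stochastic error has conditional second
moment at most `σ² a`, the squared Tikhonov bias is at most `a` times the squared Tikhonov norm of
the Taylor polynomial (which the weights in `S` bound by `∑ J^k ‖g^{(k)}(x)‖² / k!²`), and the
squared contribution of the Taylor and truncation remainders is at most `a` times their sum of
squares over the observations in the ball (`sq_estimator_sub_le`). It remains to bound the mean of
`a` by a multiple of `rateFactor / (n p)`, with `p` the probability of the ball, and to apply
Markov's inequality.

For the mean leverage, let one observation be added to the sample. The Sherman–Morrison formula
decreases `a` by at least `(d ⬝ u)² / (1 + κ)`, where `κ = 1 / (1 - δ₀)` bounds the reproducing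
kernel `d ⬝ S⁻¹ d`, a truncated geometric series in `‖v‖² < 1` (`monomials_dotProduct_le`). Since
the new design vector `d` is independent of `u`, a small ball bound `E (d ⬝ c)² ≥ γ (e₀ ⬝ c)²` for
deterministic `c` gives `E (d ⬝ u)² ≥ γ E a² ≥ γ (E a)²`. The resulting recursion
`A' ≤ A - γ A² / (1 + κ)`, started at `A ≤ 1`, implies `A ≤ 1 / (1 + n γ / (1 + κ))`
(`integral_leverage_le`).

The small ball bound (`DensityCondition.le_setLIntegral_sq`) is where the density condition enters.
Conditionally on the direction of the design point, `d ⬝ c` is a univariate polynomial `r` of degree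
at most `K - 1` in the radius `t`, with `r(0) = e₀ ⬝ c`, and by Jensen's inequality
`E r(t)² ≥ r(0)² exp (2 E log |r(t) / r(0)|)`. Each complex root `z` contributes to the exponent
through `log |1 - t / z| ≥ log |1 - t / |z||`, whose mean is at least `-(log J + 4 c₁)` when the
density `f` of `t` satisfies `t f(t) ≤ c₁ J`: the values `|1 - t / |z|| ≥ 1 / J` cost at most
`log J`, and the remaining ones add at most `4 c₁` (`exists_loss_linear`). -/

noncomputable section

namespace FLP

open scoped Matrix

/-! ### Leverages in ridge regression -/

section Ridge

variable {ι : Type*} {m : Type*}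

variable [Fintype ι]

theorem dotProduct_weight_nonneg {s : ι → ℝ} (hs : ∀ i, 0 < s i) (v : ι → ℝ) :
    0 ≤ v ⬝ᵥ (s * v) :=
  Finset.sum_nonneg fun i _ => by
    have := mul_nonneg (hs i).le (mul_self_nonneg (v i))
    simp only [Pi.mul_apply]; nlinarith

/-- The Cauchy–Schwarz inequality for the weighted inner product. -/
theorem sq_dotProduct_weight_le {s : ι → ℝ} (hs : ∀ i, 0 < s i) (v w : ι → ℝ) :
    (v ⬝ᵥ (s * w)) ^ 2 ≤ (v ⬝ᵥ (s * v)) * (w ⬝ᵥ (s * w)) := by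
  have h := Finset.sum_mul_sq_le_sq_mul_sq Finset.univ (fun i => √(s i) * v i)
    (fun i => √(s i) * w i)
  have e : ∀ x y : ι → ℝ, x ⬝ᵥ (s * y) = ∑ i, (√(s i) * x i) * (√(s i) * y i) := fun x y =>
    Finset.sum_congr rfl fun i _ => by
      have := Real.mul_self_sqrt (hs i).le
      simp only [Pi.mul_apply]; linear_combination (- x i * y i) * this
  simpa only [e, sq] using h

/-- The duality form of the weighted Cauchy–Schwarz inequality. -/
theorem sq_dotProduct_le {s : ι → ℝ} (hs : ∀ i, 0 < s i) (v w : ι → ℝ) :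
    (v ⬝ᵥ w) ^ 2 ≤ (v ⬝ᵥ (s⁻¹ * v)) * (w ⬝ᵥ (s * w)) := by
  have h := sq_dotProduct_weight_le hs (s⁻¹ * v) w
  have e1 : (s⁻¹ * v) ⬝ᵥ (s * w) = v ⬝ᵥ w := Finset.sum_congr rfl fun i _ => by
    have := (hs i).ne'
    simp only [Pi.mul_apply, Pi.inv_apply]; field_simp
  have e2 : (s⁻¹ * v) ⬝ᵥ (s * (s⁻¹ * v)) = v ⬝ᵥ (s⁻¹ * v) := Finset.sum_congr rfl fun i _ => by
    have := (hs i).ne'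
    simp only [Pi.mul_apply, Pi.inv_apply]; field_simp
  rwa [e1, e2] at h

variable [DecidableEq ι]

/-- The regularised Gram matrix `diag(s) + ∑_{j ∈ t} d_j d_jᵀ` of the design vectors `d_j`. -/
def ridge (s : ι → ℝ) (d : m → ι → ℝ) (t : Finset m) : Matrix ι ι ℝ :=
  Matrix.diagonal s + ∑ j ∈ t, Matrix.vecMulVec (d j) (d j)

theorem ridge_mulVec (s : ι → ℝ) (d : m → ι → ℝ) (t : Finset m) (v : ι → ℝ) :
    ridge s d t *ᵥ v = s * v + ∑ j ∈ t, (d j ⬝ᵥ v) • d j := by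
  rw [ridge, Matrix.add_mulVec, Matrix.sum_mulVec]
  congr 1
  · ext i; simp [Matrix.mulVec_diagonal]
  · refine Finset.sum_congr rfl fun j _ => ?_
    rw [Matrix.vecMulVec_mulVec]
    ext i; simp [mul_comm]

theorem dotProduct_ridge_mulVec (s : ι → ℝ) (d : m → ι → ℝ) (t : Finset m) (v w : ι → ℝ) :
    w ⬝ᵥ (ridge s d t *ᵥ v) = w ⬝ᵥ (s * v) + ∑ j ∈ t, (d j ⬝ᵥ v) * (d j ⬝ᵥ w) := by
  rw [ridge_mulVec, dotProduct_add, dotProduct_sum]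
  congr 1
  refine Finset.sum_congr rfl fun j _ => ?_
  rw [dotProduct_smul, smul_eq_mul, dotProduct_comm w]

theorem isUnit_det_ridge {s : ι → ℝ} (hs : ∀ i, 0 < s i) (d : m → ι → ℝ) (t : Finset m) :
    IsUnit (ridge s d t).det := by
  rw [isUnit_iff_ne_zero]
  intro h0
  obtain ⟨v, hv, hv0⟩ := Matrix.exists_mulVec_eq_zero_iff.mpr h0
  have h := dotProduct_ridge_mulVec s d t v v
  rw [hv0, dotProduct_zero] at h
  have h1 : 0 ≤ ∑ j ∈ t, (d j ⬝ᵥ v) * (d j ⬝ᵥ v) :=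
    Finset.sum_nonneg fun j _ => mul_self_nonneg _
  obtain ⟨i, hi⟩ := Function.ne_iff.mp hv
  have h2 : 0 < v ⬝ᵥ (s * v) := by
    refine Finset.sum_pos' (fun i _ => ?_) ⟨i, Finset.mem_univ i, ?_⟩
    · have := mul_nonneg (hs i).le (mul_self_nonneg (v i))
      simp only [Pi.mul_apply]; nlinarith
    · have := mul_pos (hs i) (mul_self_pos.mpr hi)
      simp only [Pi.mul_apply]; nlinarith
  linarith

/-- The solution `u` of the regularised normal equations `A u = e`. -/
def ridgeSol (s : ι → ℝ) (d : m → ι → ℝ) (t : Finset m) (e : ι → ℝ) : ι → ℝ :=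
  (ridge s d t)⁻¹ *ᵥ e

theorem ridge_mulVec_ridgeSol {s : ι → ℝ} (hs : ∀ i, 0 < s i) (d : m → ι → ℝ) (t : Finset m)
    (e : ι → ℝ) : ridge s d t *ᵥ ridgeSol s d t e = e := by
  rw [ridgeSol, Matrix.mulVec_mulVec, Matrix.mul_nonsing_inv _ (isUnit_det_ridge hs d t),
    Matrix.one_mulVec]

theorem dotProduct_ridge_symm (s : ι → ℝ) (d : m → ι → ℝ) (t : Finset m) (v w : ι → ℝ) :
    w ⬝ᵥ (ridge s d t *ᵥ v) = v ⬝ᵥ (ridge s d t *ᵥ w) := by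
  rw [dotProduct_ridge_mulVec, dotProduct_ridge_mulVec]
  congr 1
  · simp only [dotProduct, Pi.mul_apply]
    exact Finset.sum_congr rfl fun i _ => by ring
  · exact Finset.sum_congr rfl fun i _ => by ring

theorem dotProduct_ridgeSol_comm {s : ι → ℝ} (hs : ∀ i, 0 < s i) (d : m → ι → ℝ)
    (t : Finset m) (e f : ι → ℝ) : e ⬝ᵥ ridgeSol s d t f = f ⬝ᵥ ridgeSol s d t e := by
  conv_lhs => rw [← ridge_mulVec_ridgeSol hs d t e]
  conv_rhs => rw [← ridge_mulVec_ridgeSol hs d t f]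
  rw [dotProduct_comm, dotProduct_ridge_symm, dotProduct_comm]

/-- The energy identity `e ⬝ u = ⟨u, S u⟩ + ∑ (d_j ⬝ u)²`. -/
theorem dotProduct_ridgeSol_self {s : ι → ℝ} (hs : ∀ i, 0 < s i) (d : m → ι → ℝ)
    (t : Finset m) (e : ι → ℝ) :
    e ⬝ᵥ ridgeSol s d t e = ridgeSol s d t e ⬝ᵥ (s * ridgeSol s d t e) +
      ∑ j ∈ t, (d j ⬝ᵥ ridgeSol s d t e) ^ 2 := by
  have h := dotProduct_ridge_mulVec s d t (ridgeSol s d t e) (ridgeSol s d t e)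
  rw [ridge_mulVec_ridgeSol hs, dotProduct_comm] at h
  rw [h]
  simp only [sq]

theorem sum_sq_ridgeSol_le {s : ι → ℝ} (hs : ∀ i, 0 < s i) (d : m → ι → ℝ)
    (t : Finset m) (e : ι → ℝ) :
    ∑ j ∈ t, (d j ⬝ᵥ ridgeSol s d t e) ^ 2 ≤ e ⬝ᵥ ridgeSol s d t e := by
  rw [dotProduct_ridgeSol_self hs]
  linarith [dotProduct_weight_nonneg hs (ridgeSol s d t e)]

theorem weight_ridgeSol_le {s : ι → ℝ} (hs : ∀ i, 0 < s i) (d : m → ι → ℝ)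
    (t : Finset m) (e : ι → ℝ) :
    ridgeSol s d t e ⬝ᵥ (s * ridgeSol s d t e) ≤ e ⬝ᵥ ridgeSol s d t e := by
  rw [dotProduct_ridgeSol_self hs]
  linarith [Finset.sum_nonneg fun j (_ : j ∈ t) => sq_nonneg (d j ⬝ᵥ ridgeSol s d t e)]

theorem dotProduct_ridgeSol_nonneg {s : ι → ℝ} (hs : ∀ i, 0 < s i) (d : m → ι → ℝ)
    (t : Finset m) (e : ι → ℝ) : 0 ≤ e ⬝ᵥ ridgeSol s d t e :=
  (dotProduct_weight_nonneg hs _).trans (weight_ridgeSol_le hs d t e)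

/-- The leverage `e ⬝ A⁻¹ e` is at most its value `e ⬝ S⁻¹ e` without data. -/
theorem dotProduct_ridgeSol_le {s : ι → ℝ} (hs : ∀ i, 0 < s i) (d : m → ι → ℝ)
    (t : Finset m) (e : ι → ℝ) : e ⬝ᵥ ridgeSol s d t e ≤ e ⬝ᵥ (s⁻¹ * e) := by
  have h1 := sq_dotProduct_le hs e (ridgeSol s d t e)
  have h2 := weight_ridgeSol_le hs d t e
  have h3 := dotProduct_ridgeSol_nonneg hs d t e
  have h4 : 0 ≤ e ⬝ᵥ (s⁻¹ * e) :=
    dotProduct_weight_nonneg (s := s⁻¹) (fun i => inv_pos.mpr (hs i)) e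
  by_contra! h
  nlinarith [mul_le_mul_of_nonneg_left h2 h4]

theorem sq_ridgeSol_weight_le {s : ι → ℝ} (hs : ∀ i, 0 < s i) (d : m → ι → ℝ)
    (t : Finset m) (e θ : ι → ℝ) :
    (ridgeSol s d t e ⬝ᵥ (s * θ)) ^ 2 ≤ (e ⬝ᵥ ridgeSol s d t e) * (θ ⬝ᵥ (s * θ)) :=
  (sq_dotProduct_weight_le hs _ _).trans
    (mul_le_mul_of_nonneg_right (weight_ridgeSol_le hs d t e) (dotProduct_weight_nonneg hs θ))

/-- The error decomposition of the ridge estimator, when the responses are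
`d_j ⬝ θ + r_j`: a Tikhonov bias and a weighted sum of the remainders. -/
theorem ridge_error {s : ι → ℝ} (hs : ∀ i, 0 < s i) (d : m → ι → ℝ)
    (t : Finset m) (e θ : ι → ℝ) (r : m → ℝ) :
    e ⬝ᵥ ((ridge s d t)⁻¹ *ᵥ (∑ j ∈ t, (d j ⬝ᵥ θ + r j) • d j)) =
      e ⬝ᵥ θ - ridgeSol s d t e ⬝ᵥ (s * θ) + ∑ j ∈ t, r j * (d j ⬝ᵥ ridgeSol s d t e) := by
  have h := dotProduct_ridgeSol_comm hs d t e (∑ j ∈ t, (d j ⬝ᵥ θ + r j) • d j)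
  rw [ridgeSol] at h
  rw [h]
  have h2 := dotProduct_ridge_symm s d t θ (ridgeSol s d t e)
  rw [ridge_mulVec_ridgeSol hs, dotProduct_ridge_mulVec, dotProduct_comm θ e] at h2
  rw [← h2, sum_dotProduct]
  simp only [smul_dotProduct, smul_eq_mul, add_mul, Finset.sum_add_distrib]
  ring

/-- A rank-one update (Sherman–Morrison): a new design vector `d_i` decreases the leverage of `e`
by at least `(d_i ⬝ u)² / (1 + κ)`. -/
theorem dotProduct_ridgeSol_insert_le [DecidableEq m] {s : ι → ℝ} (hs : ∀ i, 0 < s i)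
    (d : m → ι → ℝ) {t : Finset m} {i : m} (hi : i ∉ t) (e : ι → ℝ) {κ : ℝ}
    (hκ : d i ⬝ᵥ (s⁻¹ * d i) ≤ κ) :
    e ⬝ᵥ ridgeSol s d (insert i t) e ≤
      e ⬝ᵥ ridgeSol s d t e - (d i ⬝ᵥ ridgeSol s d t e) ^ 2 / (1 + κ) := by
  set u := ridgeSol s d t e with hu
  set u' := ridgeSol s d (insert i t) e with hu'
  set z := ridgeSol s d t (d i) with hz
  have hA : ∀ v, ridge s d (insert i t) *ᵥ v = ridge s d t *ᵥ v + (d i ⬝ᵥ v) • d i := by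
    intro v
    rw [ridge_mulVec, ridge_mulVec, Finset.sum_insert hi]
    abel
  have h1 : ridge s d t *ᵥ u' + (d i ⬝ᵥ u') • d i = e := by
    rw [← hA]; exact ridge_mulVec_ridgeSol hs d _ e
  have key : ∀ f : ι → ℝ, f ⬝ᵥ ridgeSol s d t e =
      f ⬝ᵥ u' + (d i ⬝ᵥ u') * (f ⬝ᵥ z) := by
    intro f
    have h2 : ridgeSol s d t e = u' + (d i ⬝ᵥ u') • z := by
      conv_lhs => rw [← h1]
      rw [ridgeSol, Matrix.mulVec_add, Matrix.mulVec_smul, Matrix.mulVec_mulVec,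
        Matrix.nonsing_inv_mul _ (isUnit_det_ridge hs d t), Matrix.one_mulVec]
      rfl
    rw [h2, dotProduct_add, dotProduct_smul, smul_eq_mul]
  have ke := key e
  have kd := key (d i)
  have hez : e ⬝ᵥ z = d i ⬝ᵥ u := dotProduct_ridgeSol_comm hs d t e (d i)
  have hb0 : 0 ≤ d i ⬝ᵥ z := dotProduct_ridgeSol_nonneg hs d t (d i)
  have hb1 : d i ⬝ᵥ z ≤ κ := (dotProduct_ridgeSol_le hs d t (d i)).trans hκ
  rw [← hu] at ke kd
  rw [hez] at ke
  rw [ke, kd]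
  have : (d i ⬝ᵥ u' + d i ⬝ᵥ u' * d i ⬝ᵥ z) ^ 2 / (1 + κ) ≤
      (d i ⬝ᵥ u') * (d i ⬝ᵥ u' + d i ⬝ᵥ u' * d i ⬝ᵥ z) := by
    rw [div_le_iff₀ (by linarith)]
    nlinarith [mul_nonneg (mul_nonneg (sq_nonneg (d i ⬝ᵥ u')) (by linarith : 0 ≤ 1 + d i ⬝ᵥ z))
      (sub_nonneg.mpr hb1)]
  linarith

end Ridge

/-! ### Polynomials along a ray -/

/-- The logarithmic loss `log⁻ |y|`, without the value at `0`. -/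
def logLoss (y : ℝ) : ℝ := (Set.Ioo (-1 : ℝ) 1).indicator (fun y => -Real.log y) y

/-- An integrable majorant of `logLoss`, with total integral `4`. -/
def logMajorant (y : ℝ) : ℝ := (Set.Ioo (-1 : ℝ) 1).indicator (fun y => 1 - Real.log y) y

theorem log_nonpos_of_mem {y : ℝ} (hy : y ∈ Set.Ioo (-1 : ℝ) 1) : Real.log y ≤ 0 := by
  rw [← Real.log_abs]
  exact Real.log_nonpos (abs_nonneg y) (abs_lt.mpr hy).le

theorem logLoss_nonneg (y : ℝ) : 0 ≤ logLoss y :=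
  Set.indicator_nonneg (fun _ hy => neg_nonneg.mpr (log_nonpos_of_mem hy)) y

theorem logMajorant_nonneg (y : ℝ) : 0 ≤ logMajorant y :=
  Set.indicator_nonneg (fun _ hy => by linarith [log_nonpos_of_mem hy]) y

theorem measurable_logLoss : Measurable logLoss :=
  Real.measurable_log.neg.indicator measurableSet_Ioo

theorem exp_neg_logLoss_le {y : ℝ} (hy : y ≠ 0) : Real.exp (-logLoss y) ≤ |y| := by
  by_cases h : y ∈ Set.Ioo (-1 : ℝ) 1
  · rw [logLoss, Set.indicator_of_mem h, neg_neg, ← Real.log_abs,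
      Real.exp_log (abs_pos.mpr hy)]
  · rw [logLoss, Set.indicator_of_notMem h, neg_zero, Real.exp_zero]
    by_contra! h'
    exact h (abs_lt.mp h')

/-- The factor `1 + y / J`, which may be small for `J = 1` and `y` near `-1`, is compensated by
the loss being small there. -/
theorem logLoss_le_mul_logMajorant {J y : ℝ} (hJ : 1 ≤ J) (hy : 0 < 1 + y / J) :
    logLoss y ≤ (1 + y / J) * logMajorant y := by
  by_cases h : y ∈ Set.Ioo (-1 : ℝ) 1
  · rw [logLoss, logMajorant, Set.indicator_of_mem h, Set.indicator_of_mem h]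
    have hl := log_nonpos_of_mem h
    rcases le_or_gt 0 y with h0 | h0
    · have : 0 ≤ y / J := by positivity
      nlinarith
    · obtain ⟨u, rfl⟩ : ∃ u, y = -u := ⟨-y, by ring⟩
      rw [Real.log_neg_eq_log] at hl ⊢
      have hu : 0 < u := by linarith
      have hu1 : u < 1 := by linarith [h.1]
      have h1 := Real.one_sub_inv_le_log_of_pos hu
      have h2 : u * (-Real.log u) ≤ 1 - u := by
        have := mul_le_mul_of_nonneg_left h1 hu.le
        rw [mul_sub, mul_inv_cancel₀ hu.ne'] at this
        linarith
      have h3 : u / J * (-Real.log u) ≤ (1 - u) / J := by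
        rw [div_mul_eq_mul_div]
        exact div_le_div_of_nonneg_right h2 (by linarith)
      have h4 : (1 - u) / J + u / J ≤ 1 := by
        rw [← add_div, sub_add_cancel]
        exact (div_le_one (by linarith)).mpr hJ
      rw [neg_div]
      nlinarith
  · rw [logLoss, logMajorant, Set.indicator_of_notMem h, Set.indicator_of_notMem h, mul_zero]

theorem integrable_logMajorant : Integrable logMajorant := by
  have h : IntervalIntegrable (fun y => 1 - Real.log y) volume (-1 : ℝ) 1 :=
    intervalIntegrable_const.sub intervalIntegral.intervalIntegrable_log'
  rw [intervalIntegrable_iff_integrableOn_Ioo_of_le (by norm_num)] at h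
  exact h.integrable_indicator measurableSet_Ioo

theorem integral_logMajorant : ∫ y, logMajorant y = 4 := by
  have h : (∫ y, logMajorant y) = ∫ y in (-1 : ℝ)..1, (1 - Real.log y) := by
    rw [intervalIntegral.integral_of_le (by norm_num), integral_Ioc_eq_integral_Ioo]
    exact integral_indicator measurableSet_Ioo
  rw [h, intervalIntegral.integral_sub intervalIntegrable_const
    intervalIntegral.intervalIntegrable_log', integral_log]
  norm_num

/-- A probability density on the half-line with `t f(t) ≤ c J`. -/
structure IsLogSpread (f : ℝ → ℝ) (c J : ℝ) : Prop where
  nonneg : ∀ t, 0 ≤ f t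
  measurable : Measurable f
  integral_eq : ∫ t, f t = 1
  neg_eq : ∀ᵐ t, t < 0 → f t = 0
  mul_le : ∀ᵐ t, 0 < t → t * f t ≤ c * J

theorem IsLogSpread.integrable {f : ℝ → ℝ} {c J : ℝ} (hf : IsLogSpread f c J) :
    Integrable f := by
  by_contra h
  have := hf.integral_eq
  rw [integral_undef h] at this
  exact zero_ne_one this

/-- The mean logarithmic loss of one linear factor `t - z`: relative to its size at `t = 0`,
it is at most `log J` for those `t` with `|1 - t / |z|| ≥ 1 / J`. The remaining `t` form an interval
of length `2 |z| / J` around `|z|`, where `f(t) ≤ c J / t`, and add at most `4 c`. -/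
theorem exists_loss_linear {f : ℝ → ℝ} {c J : ℝ} (hf : IsLogSpread f c J) (hJ : 1 ≤ J)
    {z : ℂ} (hz : z ≠ 0) :
    ∃ h : ℝ → ℝ, (∀ᵐ t : ℝ, 0 < t → Real.exp (-h t) * ‖z‖ ≤ ‖(t : ℂ) - z‖) ∧
      Integrable (fun t => h t * f t) ∧ ∫ t, h t * f t ≤ Real.log J + 4 * c := by
  have hζ : 0 < ‖z‖ := norm_pos_iff.mpr hz
  set ζ := ‖z‖ with hζdef
  have hJ0 : 0 < J := by linarith
  set Y : ℝ → ℝ := fun t => J / ζ * t - J with hY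
  have hYm : Measurable Y := by fun_prop
  have hkey : ∀ᵐ t, logLoss (Y t) * f t ≤ (c * J / ζ) * logMajorant (Y t) := by
    filter_upwards [hf.neg_eq, hf.mul_le, (measure_singleton (0 : ℝ) : volume _ = 0) |>
      compl_mem_ae_iff.mpr] with t h1 h2 h3
    have h3 : t ≠ 0 := h3
    rcases lt_or_gt_of_ne h3 with h0 | h0
    · have hc : 0 ≤ (c * J / ζ) * logMajorant (Y t) := by
        have : Y t ∉ Set.Ioo (-1 : ℝ) 1 := fun h => by
          have : J / ζ * t < 0 := mul_neg_of_pos_of_neg (by positivity) h0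
          have := h.1
          simp only [hY] at this
          linarith
        rw [logMajorant, Set.indicator_of_notMem this, mul_zero]
      rw [h1 h0, mul_zero]; exact hc
    · have e : 1 + Y t / J = t / ζ := by simp only [hY]; field_simp; ring
      have h4 := logLoss_le_mul_logMajorant (y := Y t) hJ (by rw [e]; positivity)
      rw [e] at h4
      calc logLoss (Y t) * f t ≤ (t / ζ * logMajorant (Y t)) * f t :=
            mul_le_mul_of_nonneg_right h4 (hf.nonneg t)
        _ = (t * f t) * (logMajorant (Y t) / ζ) := by ring
        _ ≤ (c * J) * (logMajorant (Y t) / ζ) :=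
            mul_le_mul_of_nonneg_right (h2 h0) (div_nonneg (logMajorant_nonneg _) hζ.le)
        _ = _ := by ring
  have hmaj : Integrable (fun t => (c * J / ζ) * logMajorant (Y t)) := by
    have := (integrable_logMajorant.comp_sub_right J).comp_mul_left'
      (R := J / ζ) (by positivity)
    exact this.const_mul _
  have hmajI : ∫ t, (c * J / ζ) * logMajorant (Y t) = 4 * c := by
    rw [integral_const_mul, Measure.integral_comp_mul_left (fun y => logMajorant (y - J)),
      integral_sub_right_eq_self logMajorant J, integral_logMajorant, abs_of_pos (by positivity),
      smul_eq_mul]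
    field_simp
  have hint : Integrable (fun t => logLoss (Y t) * f t) :=
    hmaj.mono' ((measurable_logLoss.comp hYm).mul hf.measurable).aestronglyMeasurable (by
      filter_upwards [hkey] with t ht
      rwa [Real.norm_of_nonneg (mul_nonneg (logLoss_nonneg _) (hf.nonneg t))])
  refine ⟨fun t => Real.log J + logLoss (Y t), ?_, ?_, ?_⟩
  · filter_upwards [(measure_singleton ζ : volume _ = 0) |> compl_mem_ae_iff.mpr] with t ht h0
    have ht : t ≠ ζ := ht
    have hY0 : Y t ≠ 0 := by
      intro h
      have h' : J / ζ * (t - ζ) = 0 := by rw [← h]; simp only [hY]; field_simp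
      exact ht (sub_eq_zero.mp ((mul_eq_zero.mp h').resolve_left (by positivity)))
    have h1 := exp_neg_logLoss_le hY0
    rw [neg_add, Real.exp_add, Real.exp_neg, Real.exp_log hJ0]
    have h2 : |Y t| = J / ζ * |t - ζ| := by
      have h' : Y t = J / ζ * (t - ζ) := by simp only [hY]; field_simp
      rw [h', abs_mul, abs_of_pos (show 0 < J / ζ by positivity)]
    have h3 : |t - ζ| ≤ ‖(t : ℂ) - z‖ := by
      have := abs_norm_sub_norm_le (t : ℂ) z
      rwa [Complex.norm_real, Real.norm_of_nonneg h0.le] at this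
    calc J⁻¹ * Real.exp (-logLoss (Y t)) * ζ ≤ J⁻¹ * |Y t| * ζ := by gcongr
      _ = |t - ζ| := by rw [h2]; field_simp
      _ ≤ _ := h3
  · simp only [add_mul]
    exact (hf.integrable.const_mul _).add hint
  · simp only [add_mul]
    rw [integral_add (hf.integrable.const_mul _) hint, integral_const_mul, hf.integral_eq, mul_one]
    have := integral_mono_ae hint hmaj hkey
    linarith

/-- The losses of the linear factors add up. Here `h` bounds the logarithmic loss from above. -/
theorem exists_loss_prod {f : ℝ → ℝ} {c J : ℝ} (hf : IsLogSpread f c J) (hJ : 1 ≤ J)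
    (Z : Multiset ℂ) (hZ : (0 : ℂ) ∉ Z) :
    ∃ h : ℝ → ℝ, (∀ᵐ t : ℝ, 0 < t →
        Real.exp (-h t) * (Z.map fun z => ‖z‖).prod ≤ (Z.map fun z => ‖(t : ℂ) - z‖).prod) ∧
      Integrable (fun t => h t * f t) ∧
      ∫ t, h t * f t ≤ Multiset.card Z * (Real.log J + 4 * c) := by
  induction Z using Multiset.induction_on with
  | empty => exact ⟨0, by simp, by simp, by simp⟩
  | cons z Z ih =>
    rw [Multiset.mem_cons, not_or] at hZ
    obtain ⟨h₁, h1, h2, h3⟩ := ih hZ.2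
    obtain ⟨h₂, k1, k2, k3⟩ := exists_loss_linear hf hJ (Ne.symm hZ.1)
    refine ⟨fun t => h₂ t + h₁ t, ?_, ?_, ?_⟩
    · filter_upwards [h1, k1] with t ht kt h0
      rw [Multiset.map_cons, Multiset.prod_cons, Multiset.map_cons, Multiset.prod_cons, neg_add,
        Real.exp_add, mul_mul_mul_comm]
      exact mul_le_mul (kt h0) (ht h0)
        (mul_nonneg (Real.exp_pos _).le
          (Multiset.prod_nonneg fun a ha => by
            obtain ⟨b, -, rfl⟩ := Multiset.mem_map.mp ha; exact norm_nonneg _))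
        (norm_nonneg _)
    · simp only [add_mul]
      exact k2.add h2
    · simp only [add_mul]
      rw [integral_add k2 h2, Multiset.card_cons, Nat.cast_succ]
      linarith

/-- The mean logarithmic loss of a polynomial relative to its value at `0`, by factorisation
over `ℂ`. -/
theorem exists_loss_polynomial {f : ℝ → ℝ} {c J : ℝ} (hf : IsLogSpread f c J) (hJ : 1 ≤ J)
    (r : Polynomial ℝ) (hr : r.eval 0 = 1) :
    ∃ h : ℝ → ℝ, (∀ᵐ t : ℝ, 0 < t → Real.exp (-h t) ≤ |r.eval t|) ∧
      Integrable (fun t => h t * f t) ∧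
      ∃ k ≤ r.natDegree, ∫ t, h t * f t ≤ k * (Real.log J + 4 * c) := by
  set p := r.map (algebraMap ℝ ℂ) with hp
  have hev : ∀ t : ℝ, p.eval (t : ℂ) = ((r.eval t : ℝ) : ℂ) := fun t => by
    rw [hp, Polynomial.eval_map_algebraMap]
    exact Polynomial.aeval_algebraMap_apply_eq_algebraMap_eval t r
  have hsp := IsAlgClosed.splits p
  have hnorm : ∀ t : ℝ, |r.eval t| =
      ‖p.leadingCoeff‖ * (p.roots.map fun z => ‖(t : ℂ) - z‖).prod := by
    intro t
    have h1 := congrArg norm (hsp.eval_eq_prod_roots (t : ℂ))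
    rw [hev, Complex.norm_real, Real.norm_eq_abs, norm_mul] at h1
    have h2 := map_multiset_prod (normHom : ℂ →*₀ ℝ) (p.roots.map fun x => (t : ℂ) - x)
    rw [Multiset.map_map] at h2
    exact h1.trans (congrArg (‖p.leadingCoeff‖ * ·) h2)
  have h0 : (0 : ℂ) ∉ p.roots := by
    intro h
    have h1 := (Polynomial.mem_roots'.mp h).2
    have h2 := hev 0
    rw [Complex.ofReal_zero] at h2
    rw [Polynomial.IsRoot.def, h2, hr] at h1
    exact one_ne_zero (Complex.ofReal_eq_zero.mp h1)
  obtain ⟨h, h1, h2, h3⟩ := exists_loss_prod hf hJ p.roots h0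
  refine ⟨h, ?_, h2, _, ?_, h3⟩
  · filter_upwards [h1] with t ht hpos
    have e0 := hnorm 0
    simp only [hr, abs_one, Complex.ofReal_zero, zero_sub, norm_neg] at e0
    rw [hnorm t]
    calc Real.exp (-h t) = ‖p.leadingCoeff‖ *
          (Real.exp (-h t) * (p.roots.map fun z => ‖z‖).prod) := by
            linear_combination Real.exp (-h t) * e0
      _ ≤ _ := mul_le_mul_of_nonneg_left (ht hpos) (norm_nonneg _)
  · exact (Polynomial.card_roots' p).trans Polynomial.natDegree_map_le

theorem ofReal_integral_le_lintegral {α : Type*} [MeasurableSpace α] {μ : Measure α} {f : α → ℝ}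
    (hf : Integrable f μ) : ENNReal.ofReal (∫ a, f a ∂μ) ≤ ∫⁻ a, ENNReal.ofReal (f a) ∂μ := by
  rw [integral_eq_lintegral_pos_part_sub_lintegral_neg_part hf]
  refine (ENNReal.ofReal_le_ofReal (sub_le_self _ ENNReal.toReal_nonneg)).trans ?_
  exact ENNReal.ofReal_toReal_le

/-- The small ball estimate along a ray: a polynomial with `r(0) = 1` has a second moment bounded
below under every density which is spread out on the logarithmic scale. -/
theorem exp_le_lintegral_sq_polynomial {f : ℝ → ℝ} {c J : ℝ} (hf : IsLogSpread f c J)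
    (hJ : 1 ≤ J) (hc : 0 ≤ c) (r : Polynomial ℝ) (hr : r.eval 0 = 1) {D : ℕ}
    (hD : r.natDegree ≤ D) :
    ENNReal.ofReal (Real.exp (-(2 * D * (Real.log J + 4 * c)))) ≤
      ∫⁻ t, ENNReal.ofReal (r.eval t ^ 2) * ENNReal.ofReal (f t) := by
  obtain ⟨h, h1, h2, k, hk, h3⟩ := exists_loss_polynomial hf hJ r hr
  set m := 2 * D * (Real.log J + 4 * c) with hm
  have hL : 0 ≤ Real.log J + 4 * c := by have := Real.log_nonneg hJ; linarith
  have h4 : ∫ t, h t * f t ≤ D * (Real.log J + 4 * c) :=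
    h3.trans (mul_le_mul_of_nonneg_right (by exact_mod_cast hk.trans hD) hL)
  have hint : Integrable (fun t => Real.exp (-m) * ((1 + m) * f t - 2 * (h t * f t))) :=
    ((hf.integrable.const_mul _).sub (h2.const_mul 2)).const_mul _
  have hI : Real.exp (-m) ≤ ∫ t, Real.exp (-m) * ((1 + m) * f t - 2 * (h t * f t)) := by
    rw [integral_const_mul, integral_sub (hf.integrable.const_mul _) (h2.const_mul 2),
      integral_const_mul, integral_const_mul, hf.integral_eq]
    have := Real.exp_pos (-m)
    refine le_mul_of_one_le_right this.le ?_
    linarith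
  refine (ENNReal.ofReal_le_ofReal hI).trans ((ofReal_integral_le_lintegral hint).trans ?_)
  refine lintegral_mono_ae ?_
  filter_upwards [h1, hf.neg_eq, (measure_singleton (0 : ℝ) : volume _ = 0) |>
      compl_mem_ae_iff.mpr] with t ht hn h0
  have h0 : t ≠ 0 := h0
  rw [← ENNReal.ofReal_mul (sq_nonneg _)]
  apply ENNReal.ofReal_le_ofReal
  rcases lt_or_gt_of_ne h0 with h0 | h0
  · simp [hn h0]
  · have e1 : Real.exp (-h t) ^ 2 ≤ r.eval t ^ 2 := by
      rw [← sq_abs (r.eval t)]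
      exact pow_le_pow_left₀ (Real.exp_pos _).le (ht h0) 2
    have e2 : Real.exp (-h t) ^ 2 = Real.exp (-m) * Real.exp (m - 2 * h t) := by
      rw [← Real.exp_nat_mul, ← Real.exp_add]; congr 1; push_cast; ring
    -- The tangent of `exp` at `0` replaces Jensen's inequality, so that `exp (-2 h) f` need not be
    -- integrable.
    have e3 := Real.add_one_le_exp (m - 2 * h t)
    calc Real.exp (-m) * ((1 + m) * f t - 2 * (h t * f t))
        = Real.exp (-m) * (m - 2 * h t + 1) * f t := by ring
      _ ≤ Real.exp (-m) * Real.exp (m - 2 * h t) * f t := by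
          have := hf.nonneg t
          gcongr
      _ ≤ _ := by rw [← e2]; exact mul_le_mul_of_nonneg_right e1 (hf.nonneg t)

/-! ### Multinomial coefficients and Taylor polynomials -/

/-- The type of a word `l` in the letters `Fin J`: how often each letter occurs. -/
def wordType {J m : ℕ} (l : Fin m → Fin J) : Fin J → ℕ :=
  fun j => (Finset.univ.filter fun i => l i = j).card

theorem sum_wordType {J m : ℕ} (l : Fin m → Fin J) : ∑ j, wordType l j = m := by
  have := Finset.card_eq_sum_card_fiberwise (s := Finset.univ) (t := Finset.univ) (f := l)
    (fun _ _ => Finset.mem_univ _)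
  rw [Finset.card_univ, Fintype.card_fin] at this
  exact this.symm

theorem wordType_mem_piAntidiag {J m : ℕ} (l : Fin m → Fin J) :
    wordType l ∈ Finset.univ.piAntidiag m := by
  simp [Finset.mem_piAntidiag, sum_wordType]

theorem prod_wordType {R : Type*} [CommMonoid R] {J m : ℕ} (l : Fin m → Fin J) (v : Fin J → R) :
    ∏ i, v (l i) = ∏ j, v j ^ wordType l j := by
  rw [← Finset.prod_fiberwise Finset.univ l]
  refine Finset.prod_congr rfl fun j _ => ?_
  rw [Finset.prod_congr rfl (g := fun _ => v j), Finset.prod_const, wordType]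
  intro i hi
  rw [(Finset.mem_filter.mp hi).2]

/-- The multinomial coefficient counts the words of a given type: compare the coefficients of
`(X₁ + ⋯ + X_J) ^ m`. -/
theorem card_wordType_eq {J m : ℕ} {k : Fin J → ℕ} (hk : ∑ j, k j = m) :
    (Finset.univ.filter fun l : Fin m → Fin J => wordType l = k).card =
      Nat.multinomial Finset.univ k := by
  have hc : ∀ f : Fin J → ℕ, MvPolynomial.coeff (Finsupp.equivFunOnFinite.symm k)
      (∏ j, (MvPolynomial.X j : MvPolynomial (Fin J) ℕ) ^ f j) = if f = k then 1 else 0 := by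
    intro f
    rw [MvPolynomial.coeff_prod_X_pow]
    congr 1
    rw [eq_iff_iff, Finsupp.ext_iff, funext_iff]
    simp [eq_comm]
  have h := Fintype.sum_pow (fun j => (MvPolynomial.X j : MvPolynomial (Fin J) ℕ)) m
  rw [Finset.sum_pow_eq_sum_piAntidiag] at h
  have h := congrArg (MvPolynomial.coeff (Finsupp.equivFunOnFinite.symm k)) h
  rw [MvPolynomial.coeff_sum, MvPolynomial.coeff_sum] at h
  simp_rw [prod_wordType, hc, ← map_natCast (MvPolynomial.C (σ := Fin J) (R := ℕ)),
    MvPolynomial.coeff_C_mul, hc] at h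
  rw [Finset.sum_boole, Finset.sum_eq_single k (by intro b _ hb; simp [hb])
    (by intro h'; exact absurd (by simp [Finset.mem_piAntidiag, hk]) h')] at h
  simpa using h.symm

theorem sum_multiIdx {M : Type*} [AddCommMonoid M] (J K : ℕ) (F : (Fin J → ℕ) → M) :
    ∑ k : multiIdx J K, F k = ∑ m ∈ Finset.range K, ∑ k ∈ Finset.univ.piAntidiag m, F k := by
  rw [Finset.sum_coe_sort (multiIdx J K) F,
    ← Finset.sum_fiberwise_of_maps_to (t := Finset.range K) (g := fun k => ∑ l, k l)
      (fun k hk => Finset.mem_range.mpr ((mem_multiIdx k).mp hk))]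
  refine Finset.sum_congr rfl fun m hm => Finset.sum_congr ?_ fun _ _ => rfl
  ext k
  have := Finset.mem_range.mp hm
  simp only [Finset.mem_filter, mem_multiIdx, Finset.mem_piAntidiag, Finset.mem_univ, implies_true,
    and_true, and_iff_right_iff_imp]
  omega

/-- The diagonal of the Tikhonov matrix. -/
def tikhonovWeight (J K : ℕ) : multiIdx J K → ℝ :=
  fun k => 1 / (Nat.multinomial Finset.univ k.1 : ℝ)

theorem tikhonovWeight_pos (J K : ℕ) (k : multiIdx J K) : 0 < tikhonovWeight J K k :=
  one_div_pos.mpr (Nat.cast_pos.mpr (Nat.multinomial_pos _ _))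

/-- The vector of all monomials of degree `< K` at `v`. -/
def monomials {J : ℕ} (K : ℕ) (v : Fin J → ℝ) : multiIdx J K → ℝ := fun k => ∏ l, v l ^ k.1 l

open scoped Matrix

/-- The reproducing kernel of the polynomials with the Tikhonov norm is the truncated geometric
series `∑_{m < K} ⟨v, v⟩ ^ m`, which is bounded inside the unit ball independently of `J, K`. -/
theorem monomials_dotProduct_le {J : ℕ} (K : ℕ) (v : Fin J → ℝ) {ρ : ℝ} (hρ : ρ < 1)
    (hv : ∑ l, v l ^ 2 ≤ ρ) :
    monomials K v ⬝ᵥ ((tikhonovWeight J K)⁻¹ * monomials K v) ≤ 1 / (1 - ρ) := by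
  have h0 : 0 ≤ ∑ l, v l ^ 2 := Finset.sum_nonneg fun l _ => sq_nonneg _
  have e : monomials K v ⬝ᵥ ((tikhonovWeight J K)⁻¹ * monomials K v) =
      ∑ m ∈ Finset.range K, (∑ l, v l ^ 2) ^ m := by
    have h := sum_multiIdx J K fun k : Fin J → ℕ =>
      (Nat.multinomial Finset.univ k : ℝ) * ∏ l, (v l ^ 2) ^ k l
    simp only [← Finset.sum_pow_eq_sum_piAntidiag] at h
    rw [← h, dotProduct]
    refine Finset.sum_congr rfl fun k _ => ?_
    simp only [monomials, tikhonovWeight, Pi.mul_apply, Pi.inv_apply, one_div, inv_inv,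
      ← pow_mul, mul_comm 2]
    simp only [pow_mul, Finset.prod_pow]
    ring
  have h1 : (∑ l, v l ^ 2) < 1 := hv.trans_lt hρ
  have hg : (∑ m ∈ Finset.range K, (∑ l, v l ^ 2) ^ m) ≤ (1 - ∑ l, v l ^ 2)⁻¹ := by
    rw [← tsum_geometric_of_lt_one h0 h1]
    exact (summable_geometric_of_lt_one h0 h1).sum_le_tsum _ fun m _ => pow_nonneg h0 m
  rw [e, one_div]
  exact hg.trans (inv_anti₀ (by linarith) (by linarith))

section TaylorCoefficients

variable {E : Type*} [NormedAddCommGroup E] [NormedSpace ℝ E] {J : ℕ}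

/-- The coefficient of the monomial of type `k` in the homogeneous polynomial
`v ↦ G(∑ v_j φ_j, …, ∑ v_j φ_j) / m!`. -/
def homogCoeff (φ : Fin J → E) {m : ℕ} (G : ContinuousMultilinearMap ℝ (fun _ : Fin m => E) ℝ)
    (k : Fin J → ℕ) : ℝ :=
  (∑ l : Fin m → Fin J with wordType l = k, G fun i => φ (l i)) / (m.factorial : ℝ)

theorem sum_homogCoeff (φ : Fin J → E) {m : ℕ}
    (G : ContinuousMultilinearMap ℝ (fun _ : Fin m => E) ℝ) (v : Fin J → ℝ) :
    ∑ k ∈ Finset.univ.piAntidiag m, homogCoeff φ G k * ∏ j, v j ^ k j =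
      G (fun _ => ∑ j, v j • φ j) / (m.factorial : ℝ) := by
  rw [ContinuousMultilinearMap.map_sum, Finset.sum_div,
    ← Finset.sum_fiberwise_of_maps_to (t := Finset.univ.piAntidiag m) (g := wordType)
      (fun l _ => wordType_mem_piAntidiag l)]
  refine Finset.sum_congr rfl fun k _ => ?_
  rw [homogCoeff, div_mul_eq_mul_div, Finset.sum_mul, Finset.sum_div]
  refine Finset.sum_congr rfl fun l hl => ?_
  rw [ContinuousMultilinearMap.map_smul_univ, prod_wordType, (Finset.mem_filter.mp hl).2,
    smul_eq_mul, mul_comm]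

theorem abs_homogCoeff_le {φ : Fin J → E} (hφ : ∀ j, ‖φ j‖ ≤ 1) {m : ℕ}
    (G : ContinuousMultilinearMap ℝ (fun _ : Fin m => E) ℝ) {k : Fin J → ℕ}
    (hk : ∑ j, k j = m) :
    |homogCoeff φ G k| ≤ Nat.multinomial Finset.univ k * ‖G‖ / (m.factorial : ℝ) := by
  rw [homogCoeff, abs_div, Nat.abs_cast]
  gcongr
  refine (Finset.abs_sum_le_sum_abs _ _).trans ?_
  rw [← card_wordType_eq hk, ← nsmul_eq_mul]
  refine Finset.sum_le_card_nsmul _ _ _ fun l _ => ?_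
  refine (G.le_opNorm _).trans (mul_le_of_le_one_right (norm_nonneg _) ?_)
  exact Finset.prod_le_one (fun _ _ => norm_nonneg _) fun i _ => hφ _

/-- The coefficient vector of the polynomial `∑_{m < β} G_m(∑ v_j φ_j, …, ∑ v_j φ_j) / m!`. -/
def taylorCoeff (φ : Fin J → E) (K β : ℕ)
    (G : ∀ m, ContinuousMultilinearMap ℝ (fun _ : Fin m => E) ℝ) : multiIdx J K → ℝ :=
  fun k => if ∑ j, k.1 j < β then homogCoeff φ (G (∑ j, k.1 j)) k.1 else 0

theorem sum_taylorCoeff {K β : ℕ} (hβ : β ≤ K) (φ : Fin J → E)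
    (G : ∀ m, ContinuousMultilinearMap ℝ (fun _ : Fin m => E) ℝ)
    (F : (Fin J → ℕ) → ℝ → ℝ) (hF : ∀ k, F k 0 = 0) :
    ∑ k : multiIdx J K, F k.1 (taylorCoeff φ K β G k) =
      ∑ m ∈ Finset.range β, ∑ k ∈ Finset.univ.piAntidiag m, F k (homogCoeff φ (G m) k) := by
  have h := sum_multiIdx J K fun k =>
    F k (if ∑ j, k j < β then homogCoeff φ (G (∑ j, k j)) k else 0)
  refine h.trans ?_
  rw [← Finset.sum_subset (Finset.range_mono hβ)]
  · refine Finset.sum_congr rfl fun m hm => Finset.sum_congr rfl fun k hk => ?_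
    obtain rfl := (Finset.mem_piAntidiag.mp hk).1
    rw [if_pos (Finset.mem_range.mp hm)]
  · intro m _ hm
    refine Finset.sum_eq_zero fun k hk => ?_
    obtain rfl := (Finset.mem_piAntidiag.mp hk).1
    rw [if_neg (fun h => hm (Finset.mem_range.mpr h)), hF]

theorem monomials_dotProduct_taylorCoeff {K β : ℕ} (hβ : β ≤ K) (φ : Fin J → E)
    (G : ∀ m, ContinuousMultilinearMap ℝ (fun _ : Fin m => E) ℝ) (v : Fin J → ℝ) :
    monomials K v ⬝ᵥ taylorCoeff φ K β G =
      ∑ m ∈ Finset.range β, G m (fun _ => ∑ j, v j • φ j) / (m.factorial : ℝ) := by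
  have h := sum_taylorCoeff hβ φ G (fun k c => c * ∏ j, v j ^ k j) (fun k => zero_mul _)
  rw [dotProduct_comm]
  refine h.trans (Finset.sum_congr rfl fun m _ => sum_homogCoeff φ (G m) v)

/-- The Tikhonov norm of a Taylor polynomial is controlled by the operator norms of the
derivatives, since the weights are the inverse word counts. -/
theorem taylorCoeff_weight_le {K β : ℕ} (hβ : β ≤ K) {φ : Fin J → E} (hφ : ∀ j, ‖φ j‖ ≤ 1)
    (G : ∀ m, ContinuousMultilinearMap ℝ (fun _ : Fin m => E) ℝ) :
    taylorCoeff φ K β G ⬝ᵥ (tikhonovWeight J K * taylorCoeff φ K β G) ≤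
      ∑ m ∈ Finset.range β, (J : ℝ) ^ m / (m.factorial : ℝ) ^ 2 * ‖G m‖ ^ 2 := by
  have h := sum_taylorCoeff hβ φ G
    (fun k c => c * (1 / (Nat.multinomial Finset.univ k : ℝ) * c)) (fun k => by simp)
  refine h.le.trans (Finset.sum_le_sum fun m _ => ?_)
  have hJ : (J : ℝ) ^ m = ∑ k ∈ (Finset.univ : Finset (Fin J)).piAntidiag m,
      (Nat.multinomial Finset.univ k : ℝ) := by
    have := Finset.sum_pow_eq_sum_piAntidiag (Finset.univ : Finset (Fin J)) (fun _ => (1 : ℝ)) m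
    simpa using this
  rw [hJ, Finset.sum_div, Finset.sum_mul]
  refine Finset.sum_le_sum fun k hk => ?_
  have hM : 0 < (Nat.multinomial Finset.univ k : ℝ) := Nat.cast_pos.mpr (Nat.multinomial_pos _ _)
  have h1 := abs_homogCoeff_le hφ (G m) (Finset.mem_piAntidiag.mp hk).1
  have h2 := pow_le_pow_left₀ (abs_nonneg _) h1 2
  rw [sq_abs] at h2
  calc homogCoeff φ (G m) k * (1 / (Nat.multinomial Finset.univ k : ℝ) * homogCoeff φ (G m) k)
      = homogCoeff φ (G m) k ^ 2 / (Nat.multinomial Finset.univ k : ℝ) := by ring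
    _ ≤ (Nat.multinomial Finset.univ k * ‖G m‖ / (m.factorial : ℝ)) ^ 2 /
          (Nat.multinomial Finset.univ k : ℝ) := by gcongr
    _ = _ := by field_simp

end TaylorCoefficients

/-! ### Taylor's inequality -/

/-- Taylor's inequality for a chain of derivatives `f₀, f₁ = f₀', …, f_β` on `[0, 1]`. No
integrability of the last derivative is needed. -/
theorem abs_sub_taylor_le {β : ℕ} (f : ℕ → ℝ → ℝ) {M : ℝ}
    (hf : ∀ k < β, ∀ t ∈ Set.Icc (0 : ℝ) 1, HasDerivAt (f k) (f (k + 1) t) t)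
    (hM : ∀ t ∈ Set.Icc (0 : ℝ) 1, |f β t| ≤ M) :
    ∀ t ∈ Set.Icc (0 : ℝ) 1,
      |f 0 t - ∑ k ∈ Finset.range β, f k 0 / (k.factorial : ℝ) * t ^ k| ≤
        M * t ^ β / (β.factorial : ℝ) := by
  induction β generalizing f with
  | zero => intro t ht; simpa using hM t ht
  | succ β ih =>
    have ih' := ih (fun k => f (k + 1)) (fun k hk t ht => hf (k + 1) (by omega) t ht) hM
    set B : ℝ → ℝ := fun t => M * t ^ (β + 1) / ((β + 1).factorial : ℝ)
    set B' : ℝ → ℝ := fun t => M * t ^ β / (β.factorial : ℝ)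
    set F : ℝ → ℝ := fun t =>
      f 0 t - ∑ k ∈ Finset.range (β + 1), f k 0 / (k.factorial : ℝ) * t ^ k with hF
    set F' : ℝ → ℝ := fun t =>
      f 1 t - ∑ k ∈ Finset.range β, f (k + 1) 0 / (k.factorial : ℝ) * t ^ k
    have hB : ∀ t, HasDerivAt B (B' t) t := by
      intro t
      have h := (((hasDerivAt_id t).pow (β + 1)).const_mul M).div_const ((β + 1).factorial : ℝ)
      refine h.congr_deriv ?_
      simp only [B', Nat.factorial_succ, Nat.cast_mul, Nat.add_sub_cancel, id, mul_one]
      have : ((β + 1 : ℕ) : ℝ) ≠ 0 := by positivity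
      have : (β.factorial : ℝ) ≠ 0 := by positivity
      field_simp
    have hFd : ∀ t ∈ Set.Icc (0 : ℝ) 1, HasDerivAt F (F' t) t := by
      intro t ht
      have hs : HasDerivAt (fun t : ℝ => ∑ k ∈ Finset.range (β + 1),
          f k 0 / (k.factorial : ℝ) * t ^ k)
          (∑ k ∈ Finset.range β, f (k + 1) 0 / (k.factorial : ℝ) * t ^ k) t := by
        have h := HasDerivAt.fun_sum (u := Finset.range (β + 1))
          (A := fun k (t : ℝ) => f k 0 / (k.factorial : ℝ) * t ^ k) (x := t)
          (fun k _ => (hasDerivAt_pow k t).const_mul (f k 0 / (k.factorial : ℝ)))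
        refine h.congr_deriv ?_
        rw [Finset.sum_range_succ']
        simp only [Nat.cast_zero, zero_mul, mul_zero, add_zero, Nat.factorial_succ, Nat.cast_mul,
          Nat.add_sub_cancel]
        refine Finset.sum_congr rfl fun k _ => ?_
        have : ((k + 1 : ℕ) : ℝ) ≠ 0 := by positivity
        have : (k.factorial : ℝ) ≠ 0 := by positivity
        field_simp
      exact (hf 0 (by omega) t ht).sub hs
    have h0 : F 0 = 0 := by
      simp [hF, Finset.sum_range_succ']
    intro t ht
    exact image_norm_le_of_norm_deriv_right_le_deriv_boundary (f := F) (f' := F') (B := B)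
      (B' := B') (fun s hs => (hFd s hs).continuousAt.continuousWithinAt)
      (fun s hs => (hFd s ⟨hs.1, hs.2.le⟩).hasDerivWithinAt)
      (by rw [h0]; simp [B]) hB (fun s hs => ih' s ⟨hs.1, hs.2.le⟩) ht

/-- Taylor's theorem on a ball, with the sum of homogeneous terms of degree `< β`. -/
theorem FrechetDiffOnBall.abs_sub_taylor_le {g : L2 → ℝ} {x : L2} {δ : ℝ} {β : ℕ}
    (hg : FrechetDiffOnBall g x δ β) {M : ℝ}
    (hM : ∀ y ∈ Metric.ball x δ, ‖iteratedFDeriv ℝ β g y‖ ≤ M) {y : L2}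
    (hy : y ∈ Metric.ball x δ) :
    |g y - ∑ k ∈ Finset.range β, iteratedFDeriv ℝ k g x (fun _ => y - x) / (k.factorial : ℝ)| ≤
      M * δ ^ β / (β.factorial : ℝ) := by
  set h := y - x with hh
  have hδ : ‖h‖ < δ := by rwa [Metric.mem_ball, dist_eq_norm] at hy
  have hmem : ∀ t ∈ Set.Icc (0 : ℝ) 1, x + t • h ∈ Metric.ball x δ := by
    intro t ht
    rw [Metric.mem_ball, dist_eq_norm, add_sub_cancel_left, norm_smul, Real.norm_of_nonneg ht.1]
    exact (mul_le_of_le_one_left (norm_nonneg _) ht.2).trans_lt hδ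
  have key := FLP.abs_sub_taylor_le (β := β) (M := M * ‖h‖ ^ β)
    (fun k t => iteratedFDeriv ℝ k g (x + t • h) (fun _ => h)) ?_ ?_ 1 (by simp)
  · have hx : x + h = y := by rw [hh]; abel
    simp only [iteratedFDeriv_zero_apply, one_smul, zero_smul, add_zero, one_pow, mul_one, hx]
      at key
    refine key.trans ?_
    have hM0 : 0 ≤ M := (norm_nonneg _).trans (hM y hy)
    gcongr
  · intro k hk t ht
    have hd := (hg k hk _ (hmem t ht)).hasFDerivAt
    have hl : HasDerivAt (fun t : ℝ => x + t • h) h t := by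
      simpa using ((hasDerivAt_id t).smul_const h).const_add x
    have hc := hd.comp_hasDerivAt t hl
    exact ((ContinuousMultilinearMap.apply ℝ (fun _ : Fin k => L2) ℝ
      (fun _ => h)).hasFDerivAt.comp_hasDerivAt t hc).congr_deriv
        (by rw [iteratedFDeriv_succ_apply_left]; rfl)
  · intro t ht
    have h1 := (iteratedFDeriv ℝ β g (x + t • h)).le_opNorm (fun _ => h)
    rw [Finset.prod_const, Finset.card_univ, Fintype.card_fin, Real.norm_eq_abs] at h1
    exact h1.trans (mul_le_mul_of_nonneg_right (hM _ (hmem t ht)) (by positivity))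

/-! ### Conditional densities -/

section Disintegration

variable {Ω : Type*} {m mΩ : MeasurableSpace Ω} {μ : Measure Ω}

variable [IsFiniteMeasure μ]

theorem setLIntegral_condExp_indicator (hm : m ≤ mΩ) {E S : Set Ω}
    (hE : MeasurableSet E) (hS : MeasurableSet[m] S) :
    ∫⁻ ω in S, ENNReal.ofReal (μ[E.indicator (fun _ => (1 : ℝ)) | m] ω) ∂μ = μ (E ∩ S) := by
  have hi : Integrable (E.indicator fun _ => (1 : ℝ)) μ := (integrable_const 1).indicator hE
  have h0 : 0 ≤ᵐ[μ] μ[E.indicator (fun _ => (1 : ℝ)) | m] :=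
    condExp_nonneg (ae_of_all _ fun ω => Set.indicator_nonneg (fun _ _ => zero_le_one) ω)
  rw [← ofReal_integral_eq_lintegral_ofReal integrable_condExp.integrableOn
    (ae_restrict_of_ae h0), setIntegral_condExp hm hi hS, integral_indicator hE,
    setIntegral_const, smul_eq_mul, mul_one, measureReal_restrict_apply hE, measureReal_def,
    ENNReal.ofReal_toReal (measure_ne_top _ _)]

/-- A conditional probability given `m` is a density of the event, on `m`-measurable functions. -/
theorem setLIntegral_eq_lintegral_condExp_mul (hm : m ≤ mΩ) {E : Set Ω}
    (hE : MeasurableSet E) {g : Ω → ℝ≥0∞} (hg : Measurable[m] g) :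
    ∫⁻ ω in E, g ω ∂μ =
      ∫⁻ ω, ENNReal.ofReal (μ[E.indicator (fun _ => (1 : ℝ)) | m] ω) * g ω ∂μ := by
  set Φ := μ[E.indicator (fun _ => (1 : ℝ)) | m]
  have hΦ : Measurable[m] fun ω => ENNReal.ofReal (Φ ω) :=
    (stronglyMeasurable_condExp.measurable).ennreal_ofReal
  have htrim : (μ.restrict E).trim hm = (μ.withDensity fun ω => ENNReal.ofReal (Φ ω)).trim hm := by
    refine @Measure.ext _ m _ _ fun S hS => ?_
    rw [trim_measurableSet_eq hm hS, trim_measurableSet_eq hm hS, withDensity_apply _ (hm S hS),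
      setLIntegral_condExp_indicator hm hE hS, Measure.restrict_apply (hm S hS), Set.inter_comm]
  rw [← lintegral_trim hm hg, htrim, lintegral_trim hm hg,
    lintegral_withDensity_eq_lintegral_mul _ (hΦ.mono hm le_rfl) (hg.mono hm le_rfl)]
  rfl

theorem ae_restrict_condExp_indicator_pos (hm : m ≤ mΩ) {E : Set Ω}
    (hE : MeasurableSet E) :
    ∀ᵐ ω ∂(μ.restrict E), 0 < μ[E.indicator (fun _ => (1 : ℝ)) | m] ω := by
  have hS : MeasurableSet[m] {ω | μ[E.indicator (fun _ => (1 : ℝ)) | m] ω ≤ 0} :=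
    measurableSet_le stronglyMeasurable_condExp.measurable measurable_const
  have h := setLIntegral_condExp_indicator (μ := μ) hm hE hS
  rw [setLIntegral_congr_fun (g := fun _ => 0) (hm _ hS)
    (fun ω hω => ENNReal.ofReal_of_nonpos hω), lintegral_zero] at h
  rw [ae_iff]
  simp only [not_lt]
  rw [Measure.restrict_apply (hm _ hS), Set.inter_comm]
  exact h.symm

variable {W : Type*} [mW : MeasurableSpace W] {T : Ω → W} {τ : Ω → ℝ} {E : Set Ω} {p : W → ℝ → ℝ}

/-- The conditional law of `τ` given `T` and the event `E` has the density `p(T, ·)`: the ratio of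
`P[E ∩ {τ ∈ A} | T]` and `P[E | T]` is the integral of `p(T, ·)` over `A`, almost surely on
`{P[E | T] > 0}`. -/
def HasCondDensity {mΩ : MeasurableSpace Ω} (μ : Measure Ω) (E : Set Ω) (T : Ω → W)
    (τ : Ω → ℝ) (p : W → ℝ → ℝ) : Prop :=
  ∀ A : Set ℝ, MeasurableSet A → ∀ᵐ ω ∂μ,
    0 < μ[E.indicator (fun _ => (1 : ℝ)) | MeasurableSpace.comap T mW] ω →
    μ[(E ∩ τ ⁻¹' A).indicator (fun _ => (1 : ℝ)) | MeasurableSpace.comap T mW] ω /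
      μ[E.indicator (fun _ => (1 : ℝ)) | MeasurableSpace.comap T mW] ω = ∫ t in A, p (T ω) t

theorem HasCondDensity.ae_integral_eq_one (h : HasCondDensity μ E T τ p) (hT : Measurable T)
    (hE : MeasurableSet E) : ∀ᵐ ω ∂(μ.restrict E), ∫ t, p (T ω) t = 1 := by
  filter_upwards [ae_restrict_of_ae (h Set.univ MeasurableSet.univ),
    ae_restrict_condExp_indicator_pos hT.comap_le hE] with ω h1 h2
  have := h1 h2
  rw [Set.preimage_univ, Set.inter_univ, div_self h2.ne', Measure.restrict_univ] at this
  exact this.symm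

theorem HasCondDensity.ae_neg_eq_zero (h : HasCondDensity μ E T τ p) (hT : Measurable T)
    (hE : MeasurableSet E) (hτ : ∀ ω, 0 ≤ τ ω) (hp : ∀ v t, 0 ≤ p v t) :
    ∀ᵐ ω ∂(μ.restrict E), ∀ᵐ t, t < 0 → p (T ω) t = 0 := by
  filter_upwards [ae_restrict_of_ae (h (Set.Iio 0) measurableSet_Iio),
    ae_restrict_condExp_indicator_pos hT.comap_le hE, h.ae_integral_eq_one hT hE] with ω h1 h2 h3
  have h1 := h1 h2
  have he : E ∩ τ ⁻¹' Set.Iio 0 = ∅ := by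
    ext ω
    simpa using fun _ => hτ ω
  have hi : Integrable (p (T ω)) := by
    by_contra hn
    rw [integral_undef hn] at h3
    exact zero_ne_one h3
  have hz : μ[(fun _ => (0 : ℝ)) | MeasurableSpace.comap T mW] = 0 := condExp_zero
  rw [he, Set.indicator_empty, hz, Pi.zero_apply, zero_div] at h1
  have h4 := (setIntegral_eq_zero_iff_of_nonneg_ae (ae_of_all _ (hp (T ω)))
    hi.integrableOn).mp h1.symm
  exact (ae_restrict_iff' measurableSet_Iio).mp h4

/-- The conditional density disintegrates the joint law of `(T, τ)` on the event `E`. -/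
theorem HasCondDensity.setLIntegral_eq (h : HasCondDensity μ E T τ p) (hT : Measurable T)
    (hτ : Measurable τ) (hE : MeasurableSet E) (hpm : Measurable (Function.uncurry p))
    (hp : ∀ v t, 0 ≤ p v t) {F : W × ℝ → ℝ≥0∞} (hF : Measurable F) :
    ∫⁻ ω in E, F (T ω, τ ω) ∂μ =
      ∫⁻ ω in E, (∫⁻ t, F (T ω, t) * ENNReal.ofReal (p (T ω) t)) ∂μ := by
  have hm : MeasurableSpace.comap T mW ≤ mΩ := hT.comap_le
  set Φ := μ[E.indicator (fun _ => (1 : ℝ)) | MeasurableSpace.comap T mW] with hΦ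
  have hdm : Measurable fun z : W × ℝ => ENNReal.ofReal (p z.1 z.2) := hpm.ennreal_ofReal
  -- Both measures agree on rectangles.
  have key : ∀ {B : Set W} {A : Set ℝ}, MeasurableSet B → MeasurableSet A →
      (μ.restrict E).map (fun ω => (T ω, τ ω)) (B ×ˢ A) =
        ((((μ.restrict E).map T).prod volume).withDensity
          fun z => ENNReal.ofReal (p z.1 z.2)) (B ×ˢ A) := by
    intro B A hB hA
    set Ψ := μ[(E ∩ τ ⁻¹' A).indicator (fun _ => (1 : ℝ)) | MeasurableSpace.comap T mW] with hΨ
    have hEA : MeasurableSet (E ∩ τ ⁻¹' A) := hE.inter (hτ hA)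
    have hΨΦ : Ψ ≤ᵐ[μ] Φ := condExp_mono ((integrable_const 1).indicator hEA)
      ((integrable_const 1).indicator hE) (ae_of_all _ fun ω =>
        Set.indicator_le_indicator_of_subset Set.inter_subset_left (fun _ => zero_le_one) ω)
    have hTB : MeasurableSet[MeasurableSpace.comap T mW] (T ⁻¹' B) := ⟨B, hB, rfl⟩
    have hquot : Measurable[MeasurableSpace.comap T mW]
        ((T ⁻¹' B).indicator fun ω => ENNReal.ofReal (Ψ ω / Φ ω)) :=
      Measurable.indicator ((stronglyMeasurable_condExp.measurable.div
        stronglyMeasurable_condExp.measurable).ennreal_ofReal) hTB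
    have hsect : Measurable fun v => ∫⁻ t in A, ENNReal.ofReal (p v t) :=
      hdm.lintegral_prod_right'
    rw [Measure.map_apply (hT.prodMk hτ) (hB.prod hA), withDensity_apply _ (hB.prod hA),
      ← Measure.prod_restrict, lintegral_prod _ hdm.aemeasurable,
      Measure.restrict_map hT hB, lintegral_map hsect hT]
    have e1 : (μ.restrict E) ((fun ω => (T ω, τ ω)) ⁻¹' B ×ˢ A) =
        μ (E ∩ τ ⁻¹' A ∩ T ⁻¹' B) := by
      rw [Measure.restrict_apply ((hT.prodMk hτ) (hB.prod hA))]
      congr 1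
      ext ω
      simp only [Set.mem_inter_iff, Set.mem_preimage, Set.mem_prod]
      tauto
    rw [e1, ← setLIntegral_condExp_indicator hm hEA hTB, ← lintegral_indicator (hT hB),
      ← lintegral_indicator (hT hB)]
    have e2 : ∫⁻ ω in E, (T ⁻¹' B).indicator (fun ω => ∫⁻ t in A, ENNReal.ofReal (p (T ω) t)) ω ∂μ =
        ∫⁻ ω in E, (T ⁻¹' B).indicator (fun ω => ENNReal.ofReal (Ψ ω / Φ ω)) ω ∂μ := by
      refine lintegral_congr_ae ?_
      filter_upwards [ae_restrict_of_ae (h A hA), ae_restrict_condExp_indicator_pos hm hE,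
        h.ae_integral_eq_one hT hE] with ω h1 h2 h3
      have hi : Integrable (p (T ω)) := by
        by_contra hn
        rw [integral_undef hn] at h3
        exact zero_ne_one h3
      by_cases hω : ω ∈ T ⁻¹' B
      · rw [Set.indicator_of_mem hω, Set.indicator_of_mem hω, h1 h2,
          ofReal_integral_eq_lintegral_ofReal hi.integrableOn (ae_of_all _ (hp (T ω)))]
      · rw [Set.indicator_of_notMem hω, Set.indicator_of_notMem hω]
    rw [e2, setLIntegral_eq_lintegral_condExp_mul hm hE hquot]
    refine lintegral_congr_ae ?_
    filter_upwards [hΨΦ] with ω h1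
    by_cases hω : ω ∈ T ⁻¹' B
    · rw [Set.indicator_of_mem hω, Set.indicator_of_mem hω]
      rcases le_or_gt (Φ ω) 0 with h0 | h0
      · rw [ENNReal.ofReal_of_nonpos (h1.trans h0), ENNReal.ofReal_of_nonpos h0, zero_mul]
      · rw [← ENNReal.ofReal_mul h0.le, mul_div_cancel₀ _ h0.ne']
    · rw [Set.indicator_of_notMem hω, Set.indicator_of_notMem hω, mul_zero]
  rw [← lintegral_map (f := F) hF (hT.prodMk hτ), Measure.ext_prod key,
    lintegral_withDensity_eq_lintegral_mul _ hdm hF, lintegral_prod _ (hdm.mul hF).aemeasurable,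
    lintegral_map (hdm.mul hF).lintegral_prod_right' hT]
  simp only [Pi.mul_apply, mul_comm]

end Disintegration

/-! ### The small ball bound -/

theorem continuous_coords (φ : HilbertBasis ℕ ℝ L2) (x : L2) (J : ℕ) :
    Continuous (coords φ x J) := by
  unfold coords
  fun_prop

theorem continuous_monomials {J : ℕ} (K : ℕ) : Continuous (monomials (J := J) K) := by
  unfold monomials
  fun_prop

theorem continuous_seminorm {J : ℕ} (q : Seminorm ℝ (Fin J → ℝ)) : Continuous q :=
  continuousOn_univ.mp (q.convexOn.continuousOn isOpen_univ)

theorem measurable_direction {J : ℕ} (q : Seminorm ℝ (Fin J → ℝ)) : Measurable (direction q) :=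
  (continuous_seminorm q).measurable.inv.smul measurable_id

theorem smul_direction {J : ℕ} {q : Seminorm ℝ (Fin J → ℝ)} (hq : ∀ v, q v = 0 → v = 0)
    (v : Fin J → ℝ) : q v • direction q v = v := by
  by_cases h : q v = 0
  · rw [hq v h]; simp [direction]
  · rw [direction, smul_smul, mul_inv_cancel₀ h, one_smul]

/-- The restriction of the polynomial with coefficients `c` to the ray through `v`. -/
def rayPolynomial {J K : ℕ} (c : multiIdx J K → ℝ) (v : Fin J → ℝ) : Polynomial ℝ :=
  ∑ k : multiIdx J K, Polynomial.C (c k * ∏ l, v l ^ k.1 l) * Polynomial.X ^ (∑ l, k.1 l)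

theorem eval_rayPolynomial {J K : ℕ} (c : multiIdx J K → ℝ) (v : Fin J → ℝ) (t : ℝ) :
    (rayPolynomial c v).eval t = monomials K (t • v) ⬝ᵥ c := by
  simp only [rayPolynomial, Polynomial.eval_finsetSum, Polynomial.eval_mul, Polynomial.eval_C,
    Polynomial.eval_pow, Polynomial.eval_X, dotProduct, monomials, Pi.smul_apply, smul_eq_mul,
    mul_pow, Finset.prod_mul_distrib, Finset.prod_pow_eq_pow_sum]
  exact Finset.sum_congr rfl fun k _ => by ring

theorem natDegree_rayPolynomial_le {J K : ℕ} (c : multiIdx J K → ℝ) (v : Fin J → ℝ) :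
    (rayPolynomial c v).natDegree ≤ K - 1 := by
  refine Polynomial.natDegree_sum_le_of_forall_le _ _ fun k _ => ?_
  refine (Polynomial.natDegree_C_mul_X_pow_le _ _).trans ?_
  have := (mem_multiIdx k.1).mp k.2
  omega

theorem monomials_zero {J : ℕ} (K : ℕ) : monomials K (0 : Fin J → ℝ) = e0 J K := by
  ext k
  simp only [monomials, e0, Pi.zero_apply]
  by_cases h : k.1 = 0
  · simp [h]
  · rw [if_neg h]
    obtain ⟨l, hl⟩ := Function.ne_iff.mp h
    exact Finset.prod_eq_zero (Finset.mem_univ l) (zero_pow hl)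

theorem eval_zero_rayPolynomial {J K : ℕ} (c : multiIdx J K → ℝ) (v : Fin J → ℝ) :
    (rayPolynomial c v).eval 0 = e0 J K ⬝ᵥ c := by
  rw [eval_rayPolynomial, zero_smul, monomials_zero]

theorem sq_mul_exp_le_lintegral_sq_polynomial {f : ℝ → ℝ} {c J : ℝ} (hf : IsLogSpread f c J)
    (hJ : 1 ≤ J) (hc : 0 ≤ c) (r : Polynomial ℝ) {D : ℕ} (hD : r.natDegree ≤ D) :
    ENNReal.ofReal (r.eval 0 ^ 2) * ENNReal.ofReal (Real.exp (-(2 * D * (Real.log J + 4 * c)))) ≤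
      ∫⁻ t, ENNReal.ofReal (r.eval t ^ 2) * ENNReal.ofReal (f t) := by
  set a := r.eval 0 with ha
  by_cases h0 : a = 0
  · simp [h0]
  · have h := exp_le_lintegral_sq_polynomial hf hJ hc (Polynomial.C a⁻¹ * r)
      (by rw [Polynomial.eval_mul, Polynomial.eval_C, ← ha, inv_mul_cancel₀ h0])
      ((Polynomial.natDegree_C_mul_le _ _).trans hD)
    have hm : Measurable fun t => ENNReal.ofReal ((Polynomial.C a⁻¹ * r).eval t ^ 2) *
        ENNReal.ofReal (f t) :=
      ((Polynomial.continuous _).pow 2).measurable.ennreal_ofReal.mul hf.measurable.ennreal_ofReal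
    refine (mul_le_mul_right h (ENNReal.ofReal (a ^ 2))).trans ?_
    rw [← lintegral_const_mul _ hm]
    refine lintegral_mono fun t => ?_
    rw [← mul_assoc, ← ENNReal.ofReal_mul (sq_nonneg a)]
    apply le_of_eq
    congr 2
    rw [Polynomial.eval_mul, Polynomial.eval_C]
    field_simp

/-- The small ball bound: under the density condition, every polynomial in the first `J`
coordinates has a second moment on the ball bounded below in terms of its value at the centre. -/
theorem DensityCondition.le_setLIntegral_sq {Ω : Type*} [MeasurableSpace Ω] {μ : Measure Ω}
    [IsProbabilityMeasure μ] {Z : Ω → L2} {φ : HilbertBasis ℕ ℝ L2} {x : L2} {δ : ℝ} {J K : ℕ}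
    {q : Seminorm ℝ (Fin J → ℝ)} {c₁ c₂ : ℝ} (h : DensityCondition μ Z φ x δ q c₁ c₂)
    (hZ : Measurable Z) (hq : ∀ v, q v = 0 → v = 0) (hJ : 0 < J) (hc₁ : 0 < c₁)
    (c : multiIdx J K → ℝ) :
    ENNReal.ofReal ((e0 J K ⬝ᵥ c) ^ 2) *
        (ENNReal.ofReal (Real.exp (-(2 * (K - 1 : ℕ) * (Real.log J + 4 * c₁)))) *
          (μ (Z ⁻¹' Metric.ball x δ) / ENNReal.ofReal c₂)) ≤
      ∫⁻ ω in Z ⁻¹' Metric.ball x δ,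
        ENNReal.ofReal ((monomials K (coords φ x J (Z ω)) ⬝ᵥ c) ^ 2) ∂μ := by
  obtain ⟨p, ⟨hpm, hp, hdens⟩, hprob⟩ := h
  set E := Z ⁻¹' Metric.ball x δ
  set V : Ω → Fin J → ℝ := fun ω => coords φ x J (Z ω) with hV
  set T : Ω → Fin J → ℝ := fun ω => direction q (V ω) with hTdef
  have hVm : Measurable V := (continuous_coords φ x J).measurable.comp hZ
  have hT : Measurable T := (measurable_direction q).comp hVm
  have hτ : Measurable fun ω => q (V ω) := (continuous_seminorm q).measurable.comp hVm
  have hE : MeasurableSet E := hZ measurableSet_ball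
  have hcond : HasCondDensity μ E T (fun ω => q (V ω)) p := hdens
  set F : (Fin J → ℝ) × ℝ → ℝ≥0∞ := fun z =>
    ENNReal.ofReal ((monomials K (z.2 • z.1) ⬝ᵥ c) ^ 2) with hFdef
  have hF : Measurable F := by
    have : Continuous fun z : (Fin J → ℝ) × ℝ => (monomials K (z.2 • z.1) ⬝ᵥ c) ^ 2 :=
      (((continuous_monomials K).comp (continuous_snd.smul continuous_fst)).dotProduct
        continuous_const).pow 2
    exact this.measurable.ennreal_ofReal
  have hFV : ∀ ω, F (T ω, q (V ω)) = ENNReal.ofReal ((monomials K (V ω) ⬝ᵥ c) ^ 2) := fun ω => by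
    simp only [hFdef, hTdef, smul_direction hq]
  -- Only the condition for almost every `t` defines a set which is clearly measurable.
  set D : Set (Fin J → ℝ) := {v | ∀ᵐ t : ℝ, 0 < t → t * p v t ≤ c₁ * J} with hD
  have hDm : MeasurableSet D := by
    have hbad : MeasurableSet {z : (Fin J → ℝ) × ℝ | ¬ (0 < z.2 → z.2 * p z.1 z.2 ≤ c₁ * J)} := by
      refine (MeasurableSet.compl ?_)
      have h1 : MeasurableSet {z : (Fin J → ℝ) × ℝ | 0 < z.2} :=
        measurableSet_lt measurable_const measurable_snd
      have h2 : MeasurableSet {z : (Fin J → ℝ) × ℝ | z.2 * p z.1 z.2 ≤ c₁ * J} :=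
        measurableSet_le (measurable_snd.mul hpm) measurable_const
      exact h1.imp h2
    exact measurable_measure_prodMk_left (ν := volume) hbad (measurableSet_singleton 0)
  have hED : μ E / ENNReal.ofReal c₂ ≤ μ (E ∩ T ⁻¹' D) :=
    hprob.trans (measure_mono fun ω hω => ⟨hω.1, ae_of_all _ hω.2⟩)
  have e1 : ∫⁻ ω in E, ENNReal.ofReal ((monomials K (V ω) ⬝ᵥ c) ^ 2) ∂μ =
      ∫⁻ ω in E, F (T ω, q (V ω)) ∂μ := by simp only [hFV]
  rw [e1, hcond.setLIntegral_eq hT hτ hE hpm hp hF]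
  calc _ ≤ ENNReal.ofReal ((e0 J K ⬝ᵥ c) ^ 2) *
        (ENNReal.ofReal (Real.exp (-(2 * (K - 1 : ℕ) * (Real.log J + 4 * c₁)))) *
          μ (E ∩ T ⁻¹' D)) := by gcongr
    _ = ∫⁻ ω in E ∩ T ⁻¹' D, ENNReal.ofReal ((e0 J K ⬝ᵥ c) ^ 2) *
        ENNReal.ofReal (Real.exp (-(2 * (K - 1 : ℕ) * (Real.log J + 4 * c₁)))) ∂μ := by
      rw [setLIntegral_const]
      ring
    _ ≤ ∫⁻ ω in E ∩ T ⁻¹' D, (∫⁻ t, F (T ω, t) * ENNReal.ofReal (p (T ω) t)) ∂μ := by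
      refine lintegral_mono_ae ?_
      filter_upwards [ae_restrict_mem (hE.inter (hT hDm)),
        ae_restrict_of_ae_restrict_of_subset Set.inter_subset_left
          (hcond.ae_integral_eq_one hT hE),
        ae_restrict_of_ae_restrict_of_subset Set.inter_subset_left
          (hcond.ae_neg_eq_zero hT hE (fun ω => apply_nonneg q _) hp)] with ω h1 h2 h3
      have hs : IsLogSpread (p (T ω)) c₁ J :=
        ⟨hp _, hpm.comp measurable_prodMk_left, h2, h3, h1.2⟩
      have := sq_mul_exp_le_lintegral_sq_polynomial hs (by exact_mod_cast hJ) hc₁.le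
        (rayPolynomial c (T ω)) (natDegree_rayPolynomial_le c (T ω))
      rw [eval_zero_rayPolynomial] at this
      simpa only [eval_rayPolynomial] using this
    _ ≤ _ := lintegral_mono_set Set.inter_subset_left

/-! ### The mean leverage -/

section Leverage

theorem measurable_ridgeSol {ι m : Type*} [Fintype ι] [DecidableEq ι] [Finite m] (s : ι → ℝ)
    (t : Finset m) (e : ι → ℝ) : Measurable fun d : m → ι → ℝ => ridgeSol s d t e := by
  have hA : Continuous fun d : m → ι → ℝ => ridge s d t := by
    unfold ridge
    refine continuous_const.add (continuous_finsetSum _ fun j _ => ?_)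
    exact (continuous_apply j).matrix_vecMulVec (continuous_apply j)
  have h : ∀ d : m → ι → ℝ, ridgeSol s d t e =
      (ridge s d t).det⁻¹ • ((ridge s d t).adjugate *ᵥ e) := fun d => by
    rw [ridgeSol, Matrix.inv_def, Ring.inverse_eq_inv, Matrix.smul_mulVec]
  simp_rw [h]
  exact hA.matrix_det.measurable.inv.smul
    (hA.matrix_adjugate.matrix_mulVec continuous_const).measurable

theorem ridgeSol_congr {ι m : Type*} [Fintype ι] [DecidableEq ι] (s : ι → ℝ) {d d' : m → ι → ℝ}
    {t : Finset m} (h : ∀ j ∈ t, d j = d' j) (e : ι → ℝ) :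
    ridgeSol s d t e = ridgeSol s d' t e := by
  have : ridge s d t = ridge s d' t := by
    unfold ridge
    congr 1
    exact Finset.sum_congr rfl fun j hj => by rw [h j hj]
  rw [ridgeSol, ridgeSol, this]

variable {Ω S ι m : Type*} [MeasurableSpace Ω] [MeasurableSpace S] [Fintype ι] [DecidableEq ι]
  [Finite m] [DecidableEq m] {μ : Measure Ω}

theorem indepFun_ridgeSol {X : m → Ω → S} (hX : ∀ j, Measurable (X j)) (hind : iIndepFun X μ)
    {D : S → ι → ℝ} (hD : Measurable D) (s : ι → ℝ) {t : Finset m} {i : m} (hi : i ∉ t)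
    (e : ι → ℝ) :
    IndepFun (X i) (fun ω => ridgeSol s (fun j => D (X j ω)) t e) μ := by
  have h := hind.indepFun_finset {i} t (Finset.disjoint_singleton_left.mpr hi) hX
  have hψ : Measurable fun z : t → S =>
      ridgeSol s (fun j => if h : j ∈ t then D (z ⟨j, h⟩) else 0) t e := by
    refine (measurable_ridgeSol s t e).comp (measurable_pi_iff.mpr fun j => ?_)
    by_cases hj : j ∈ t
    · simp only [hj, dite_true]
      exact hD.comp (measurable_pi_apply _)
    · simp only [hj, dite_false]
      exact measurable_const
  have h2 := h.comp (measurable_pi_apply (⟨i, Finset.mem_singleton_self i⟩ : ({i} : Finset m))) hψ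
  have e1 : (fun ω => ridgeSol s (fun j => D (X j ω)) t e) =
      (fun z : t → S => ridgeSol s (fun j => if h : j ∈ t then D (z ⟨j, h⟩) else 0) t e) ∘
        fun ω (j : t) => X j ω :=
    funext fun ω => ridgeSol_congr s (fun j hj => by simp [hj]) e
  rw [e1]
  exact h2

variable [IsProbabilityMeasure μ]

/-- One more observation decreases the mean leverage `E a` at least by a multiple of `(E a)²`:
the new design vector is independent of the previous solution `u`, whose value at the centre is
`a`, so that the small ball bound applies conditionally. -/
theorem integral_leverage_insert_le {X : m → Ω → S} (hX : ∀ j, Measurable (X j))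
    (hind : iIndepFun X μ) {D : S → ι → ℝ} (hD : Measurable D) {s : ι → ℝ} (hs : ∀ i, 0 < s i)
    {e : ι → ℝ} (he : e ⬝ᵥ (s⁻¹ * e) ≤ 1) {κ γ : ℝ} (hκ : ∀ y, D y ⬝ᵥ (s⁻¹ * D y) ≤ κ)
    (hκ0 : 0 ≤ κ) (hγ : 0 ≤ γ) (hball : ∀ i (c : ι → ℝ),
      ENNReal.ofReal (γ * (e ⬝ᵥ c) ^ 2) ≤ ∫⁻ ω, ENNReal.ofReal ((D (X i ω) ⬝ᵥ c) ^ 2) ∂μ)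
    {t : Finset m} {i : m} (hi : i ∉ t) :
    ∫ ω, e ⬝ᵥ ridgeSol s (fun j => D (X j ω)) (insert i t) e ∂μ ≤
      ∫ ω, e ⬝ᵥ ridgeSol s (fun j => D (X j ω)) t e ∂μ -
        γ / (1 + κ) * (∫ ω, e ⬝ᵥ ridgeSol s (fun j => D (X j ω)) t e ∂μ) ^ 2 := by
  have hDX : Measurable fun ω => fun j => D (X j ω) :=
    measurable_pi_iff.mpr fun j => hD.comp (hX j)
  have hUm : ∀ t, Measurable fun ω => ridgeSol s (fun j => D (X j ω)) t e := fun t =>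
    (measurable_ridgeSol s t e).comp hDX
  have hdot : Measurable fun z : (ι → ℝ) × (ι → ℝ) => z.1 ⬝ᵥ z.2 :=
    (continuous_fst.dotProduct continuous_snd).measurable
  set a : Finset m → Ω → ℝ := fun t ω => e ⬝ᵥ ridgeSol s (fun j => D (X j ω)) t e with ha
  have ham : ∀ t, Measurable (a t) := fun t => hdot.comp (measurable_const.prodMk (hUm t))
  have ha0 : ∀ t ω, 0 ≤ a t ω := fun t ω => dotProduct_ridgeSol_nonneg hs _ t e
  have ha1 : ∀ t ω, a t ω ≤ 1 := fun t ω => (dotProduct_ridgeSol_le hs _ t e).trans he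
  have hai : ∀ t, Integrable (a t) μ := fun t =>
    Integrable.of_bound (ham t).aestronglyMeasurable 1 (ae_of_all _ fun ω => by
      rw [Real.norm_of_nonneg (ha0 t ω)]; exact ha1 t ω)
  have hai2 : Integrable (fun ω => a t ω ^ 2) μ :=
    Integrable.of_bound ((ham t).pow_const 2).aestronglyMeasurable 1 (ae_of_all _ fun ω => by
      rw [Real.norm_of_nonneg (sq_nonneg _)]; exact pow_le_one₀ (ha0 t ω) (ha1 t ω))
  set U : Ω → ι → ℝ := fun ω => ridgeSol s (fun j => D (X j ω)) t e with hU
  set w : Ω → ℝ := fun ω => D (X i ω) ⬝ᵥ U ω with hw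
  have hwm : Measurable w := hdot.comp ((hD.comp (hX i)).prodMk (hUm t))
  have hwb : ∀ ω, w ω ^ 2 ≤ κ := fun ω => by
    refine (sq_dotProduct_le hs _ _).trans ?_
    have h1 := (weight_ridgeSol_le hs (fun j => D (X j ω)) t e).trans (ha1 t ω)
    have h2 := dotProduct_weight_nonneg hs (U ω)
    exact (mul_le_mul (hκ _) h1 h2 hκ0).trans_eq (mul_one κ)
  have hwi : Integrable (fun ω => w ω ^ 2) μ :=
    Integrable.of_bound (hwm.pow_const 2).aestronglyMeasurable κ (ae_of_all _ fun ω => by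
      rw [Real.norm_of_nonneg (sq_nonneg _)]; exact hwb ω)
  have hlow : γ * ∫ ω, a t ω ^ 2 ∂μ ≤ ∫ ω, w ω ^ 2 ∂μ := by
    have hprod := (indepFun_iff_map_prod_eq_prod_map_map (hX i).aemeasurable
      (hUm t).aemeasurable).mp (indepFun_ridgeSol hX hind hD s hi e)
    set F : S × (ι → ℝ) → ℝ≥0∞ := fun z => ENNReal.ofReal ((D z.1 ⬝ᵥ z.2) ^ 2)
    have hF : Measurable F :=
      ((hdot.comp ((hD.comp measurable_fst).prodMk measurable_snd)).pow_const 2).ennreal_ofReal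
    have e1 : ∫⁻ ω, ENNReal.ofReal (w ω ^ 2) ∂μ =
        ∫⁻ u, ∫⁻ y, F (y, u) ∂(μ.map (X i)) ∂(μ.map U) := by
      rw [← lintegral_prod_symm _ hF.aemeasurable, ← hprod,
        lintegral_map hF ((hX i).prodMk (hUm t))]
    have e2 : ∫⁻ ω, ENNReal.ofReal (γ * a t ω ^ 2) ∂μ ≤ ∫⁻ ω, ENNReal.ofReal (w ω ^ 2) ∂μ := by
      rw [e1, lintegral_map hF.lintegral_prod_left' (hUm t)]
      refine lintegral_mono fun ω => ?_
      have e3 := lintegral_map (μ := μ) (hF.comp (measurable_prodMk_right (y := U ω))) (hX i)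
      exact (hball i (U ω)).trans e3.ge
    rw [← ofReal_integral_eq_lintegral_ofReal hwi (ae_of_all _ fun ω => sq_nonneg _),
      ← ofReal_integral_eq_lintegral_ofReal (hai2.const_mul γ)
        (ae_of_all _ fun ω => mul_nonneg hγ (sq_nonneg _)), integral_const_mul] at e2
    exact (ENNReal.ofReal_le_ofReal_iff (integral_nonneg fun ω => sq_nonneg _)).mp e2
  have hjen : (∫ ω, a t ω ∂μ) ^ 2 ≤ ∫ ω, a t ω ^ 2 ∂μ := by
    have h2 : MemLp (a t) 2 μ := MemLp.of_bound (ham t).aestronglyMeasurable 1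
      (ae_of_all _ fun ω => by rw [Real.norm_of_nonneg (ha0 t ω)]; exact ha1 t ω)
    have h := variance_nonneg (a t) μ
    rw [variance_eq_sub h2] at h
    exact sub_nonneg.mp h
  have hstep : ∫ ω, a (insert i t) ω ∂μ ≤ ∫ ω, (a t ω - w ω ^ 2 / (1 + κ)) ∂μ :=
    integral_mono (hai _) ((hai t).sub (hwi.div_const _)) fun ω =>
      dotProduct_ridgeSol_insert_le hs (fun j => D (X j ω)) hi e (hκ _)
  rw [integral_sub (hai t) (hwi.div_const _), integral_div] at hstep
  have h4 : γ / (1 + κ) * (∫ ω, a t ω ∂μ) ^ 2 ≤ (∫ ω, w ω ^ 2 ∂μ) / (1 + κ) := by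
    rw [div_mul_eq_mul_div]
    refine div_le_div_of_nonneg_right ?_ (by linarith)
    exact (mul_le_mul_of_nonneg_left hjen hγ).trans hlow
  exact hstep.trans (by linarith)

/-- The mean leverage decreases like the inverse sample size: the recursion `A' ≤ A - g A²` for the
mean leverages is solved by `A ≤ 1 / (1 + g N)`. -/
theorem integral_leverage_le {X : m → Ω → S} (hX : ∀ j, Measurable (X j))
    (hind : iIndepFun X μ) {D : S → ι → ℝ} (hD : Measurable D) {s : ι → ℝ} (hs : ∀ i, 0 < s i)
    {e : ι → ℝ} (he : e ⬝ᵥ (s⁻¹ * e) ≤ 1) {κ γ : ℝ} (hκ : ∀ y, D y ⬝ᵥ (s⁻¹ * D y) ≤ κ)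
    (hκ0 : 0 ≤ κ) (hγ : 0 ≤ γ) (hball : ∀ i (c : ι → ℝ),
      ENNReal.ofReal (γ * (e ⬝ᵥ c) ^ 2) ≤ ∫⁻ ω, ENNReal.ofReal ((D (X i ω) ⬝ᵥ c) ^ 2) ∂μ)
    (t : Finset m) :
    (∫ ω, e ⬝ᵥ ridgeSol s (fun j => D (X j ω)) t e ∂μ) * (1 + γ / (1 + κ) * t.card) ≤ 1 := by
  have hnn : ∀ t : Finset m, 0 ≤ ∫ ω, e ⬝ᵥ ridgeSol s (fun j => D (X j ω)) t e ∂μ := fun t =>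
    integral_nonneg fun ω => dotProduct_ridgeSol_nonneg hs _ t e
  induction t using Finset.induction_on with
  | empty =>
    rw [Finset.card_empty, Nat.cast_zero, mul_zero, add_zero, mul_one]
    have h := norm_integral_le_of_norm_le_const (μ := μ) (C := 1)
      (f := fun ω => e ⬝ᵥ ridgeSol s (fun j => D (X j ω)) ∅ e) (ae_of_all _ fun ω => by
        rw [Real.norm_of_nonneg (dotProduct_ridgeSol_nonneg hs _ _ e)]
        exact (dotProduct_ridgeSol_le hs _ _ e).trans he)
    rw [probReal_univ, mul_one] at h
    exact (le_abs_self _).trans h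
  | insert i t hi ih =>
    have h := integral_leverage_insert_le hX hind hD hs he hκ hκ0 hγ hball hi
    rw [Finset.card_insert_of_notMem hi, Nat.cast_succ]
    have h1 := hnn t
    set A := ∫ ω, e ⬝ᵥ ridgeSol s (fun j => D (X j ω)) t e ∂μ
    set g := γ / (1 + κ)
    have hg : 0 ≤ g := div_nonneg hγ (by linarith)
    set N : ℝ := (t.card : ℝ)
    have hN : 0 ≤ N := Nat.cast_nonneg _
    refine (mul_le_mul_of_nonneg_right h (by positivity)).trans ?_
    -- With `v = 1 + g N` and `A v ≤ 1`: `(A - g A²)(v + g) = A v - g A (A v - 1) - g² A² ≤ 1`.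
    have h2 : 0 ≤ (1 - A * (1 + g * N)) * (1 - g * A) ∨ 1 < g * A := by
      rcases le_or_gt (g * A) 1 with h3 | h3
      · exact Or.inl (mul_nonneg (by linarith) (by linarith))
      · exact Or.inr h3
    rcases h2 with h2 | h2
    · nlinarith [sq_nonneg (g * A)]
    · have : (A - g * A ^ 2) * (1 + g * (N + 1)) ≤ 0 :=
        mul_nonpos_of_nonpos_of_nonneg (by nlinarith) (by positivity)
      linarith

end Leverage

/-! ### The stochastic error -/

section Noise

variable {Ω : Type*} [MeasurableSpace Ω] {μ : Measure Ω}

/-- The `i`-th observation is independent of the sample in which it is replaced by the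
constant `z₀`. -/
theorem indepFun_rest {m S : Type*} [Fintype m] [DecidableEq m] [MeasurableSpace S]
    {Z : m → Ω → S} (hZ : ∀ j, Measurable (Z j)) (hind : iIndepFun Z μ) (i : m) (z₀ : S) :
    IndepFun (Z i) (fun ω l => if l = i then z₀ else Z l ω) μ := by
  have h := hind.indepFun_finset {i} (Finset.univ.erase i) (by simp) hZ
  have hψ : Measurable fun (z : ↥(Finset.univ.erase i) → S) (l : m) =>
      if hl : l ∈ Finset.univ.erase i then z ⟨l, hl⟩ else z₀ := by
    refine measurable_pi_iff.mpr fun l => ?_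
    by_cases hl : l ∈ Finset.univ.erase i
    · simp only [hl, dite_true]
      exact measurable_pi_apply _
    · simp only [hl, dite_false]
      exact measurable_const
  have h2 := h.comp (measurable_pi_apply (⟨i, Finset.mem_singleton_self i⟩ : ({i} : Finset m))) hψ
  have e1 : (fun ω l => if l = i then z₀ else Z l ω) =
      (fun (z : ↥(Finset.univ.erase i) → S) (l : m) =>
        if hl : l ∈ Finset.univ.erase i then z ⟨l, hl⟩ else z₀) ∘
        fun ω (j : ↥(Finset.univ.erase i)) => Z j ω := by
    funext ω l
    by_cases hl : l = i <;> simp [hl]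
  rw [e1]
  exact h2

variable {n : ℕ} {X : Fin n → Ω → L2} {Y : Fin n → Ω → ℝ} {g : L2 → ℝ} {σ : ℝ}

theorem IsRegressionSample.integrable_mul_errors (h : IsRegressionSample μ X Y g σ)
    (i j : Fin n) {W : (Fin n → L2) → ℝ} (hW : Measurable W) {B : ℝ} (hB : ∀ z, |W z| ≤ B) :
    Integrable (fun ω => W (fun l => X l ω) * ((Y i ω - g (X i ω)) * (Y j ω - g (X j ω)))) μ :=
  ((h.error_memLp i).integrable_mul (h.error_memLp j)).bdd_mul
    (hW.comp (measurable_pi_iff.mpr h.measurable_X)).aestronglyMeasurable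
    (ae_of_all _ fun _ => hB _)

variable [IsProbabilityMeasure μ]

/-- Fubini's theorem for independent observations: the `i`-th one can be integrated first, with
all the other ones frozen. -/
theorem integral_eq_integral_integral_update {m S : Type*} [Fintype m] [DecidableEq m]
    [MeasurableSpace S] {Z : m → Ω → S} (hZ : ∀ j, Measurable (Z j)) (hind : iIndepFun Z μ)
    (i : m) {F : (m → S) → ℝ} (hF : Measurable F)
    (hint : Integrable (fun ω => F fun l => Z l ω) μ) :
    Integrable (fun ω => ∫ ω', F (fun l => if l = i then Z i ω' else Z l ω) ∂μ) μ ∧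
    ∫ ω, F (fun l => Z l ω) ∂μ =
      ∫ ω, ∫ ω', F (fun l => if l = i then Z i ω' else Z l ω) ∂μ ∂μ := by
  obtain ⟨ω₀⟩ : Nonempty Ω := nonempty_of_isProbabilityMeasure μ
  set R : Ω → m → S := fun ω l => if l = i then Z i ω₀ else Z l ω with hRdef
  have hR : Measurable R := measurable_pi_iff.mpr fun l => by
    by_cases hl : l = i
    · simp only [hRdef, hl, if_true]; exact measurable_const
    · simp only [hRdef, hl, if_false]; exact hZ l
  have hprod := (indepFun_iff_map_prod_eq_prod_map_map hR.aemeasurable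
    (hZ i).aemeasurable).mp (indepFun_rest hZ hind i (Z i ω₀)).symm
  set G : (m → S) × S → ℝ := fun p => F fun l => if l = i then p.2 else p.1 l with hGdef
  have hG : Measurable G := by
    refine hF.comp (measurable_pi_iff.mpr fun l => ?_)
    by_cases hl : l = i
    · simp only [hl, if_true]; exact measurable_snd
    · simp only [hl, if_false]; exact (measurable_pi_apply l).comp measurable_fst
  have hGR : ∀ ω, G (R ω, Z i ω) = F fun l => Z l ω := fun ω => by
    simp only [hGdef, hRdef]
    congr 1
    funext l
    by_cases hl : l = i <;> simp [hl]
  have hGR2 : ∀ ω ω', G (R ω, Z i ω') = F fun l => if l = i then Z i ω' else Z l ω := fun ω ω' => by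
    simp only [hGdef, hRdef]
    congr 1
    funext l
    by_cases hl : l = i <;> simp [hl]
  have hGi : Integrable G ((μ.map R).prod (μ.map (Z i))) := by
    rw [← hprod, integrable_map_measure hG.aestronglyMeasurable (hR.prodMk (hZ i)).aemeasurable]
    exact hint.congr (ae_of_all _ fun ω => (hGR ω).symm)
  have hin : ∀ ω, ∫ z, G (R ω, z) ∂(μ.map (Z i)) =
      ∫ ω', F (fun l => if l = i then Z i ω' else Z l ω) ∂μ := fun ω => by
    have h := integral_map (μ := μ) (hZ i).aemeasurable
      (hG.comp (measurable_prodMk_left (x := R ω))).aestronglyMeasurable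
    exact h.trans (integral_congr_ae (ae_of_all _ fun ω' => hGR2 ω ω'))
  have hI := hGi.integral_prod_left
  constructor
  · have h := (integrable_map_measure hI.aestronglyMeasurable hR.aemeasurable).mp hI
    exact h.congr (ae_of_all _ hin)
  · calc ∫ ω, F (fun l => Z l ω) ∂μ = ∫ ω, G (R ω, Z i ω) ∂μ :=
          integral_congr_ae (ae_of_all _ fun ω => (hGR ω).symm)
      _ = ∫ p, G p ∂((μ.map R).prod (μ.map (Z i))) := by
          rw [← hprod, integral_map (hR.prodMk (hZ i)).aemeasurable hG.aestronglyMeasurable]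
      _ = ∫ ω, ∫ z, G (R ω, z) ∂(μ.map (Z i)) ∂μ := by
          rw [integral_prod _ hGi, integral_map hR.aemeasurable hI.aestronglyMeasurable]
      _ = _ := integral_congr_ae (ae_of_all _ hin)

theorem IsRegressionSample.integral_mul_error (h : IsRegressionSample μ X Y g σ) (i : Fin n)
    {f : L2 → ℝ} (hf : Measurable f) {B : ℝ} (hB : ∀ y, |f y| ≤ B) :
    ∫ ω, f (X i ω) * (Y i ω - g (X i ω)) ∂μ = 0 := by
  have hm := (h.measurable_X i).comap_le
  have hε : Integrable (fun ω => Y i ω - g (X i ω)) μ := (h.error_memLp i).integrable one_le_two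
  have hfX : StronglyMeasurable[MeasurableSpace.comap (X i) inferInstance] (f ∘ X i) :=
    (hf.comp (comap_measurable (X i))).stronglyMeasurable
  have hprod : Integrable ((f ∘ X i) * fun ω => Y i ω - g (X i ω)) μ :=
    hε.bdd_mul (hf.comp (h.measurable_X i)).aestronglyMeasurable (ae_of_all _ fun ω => hB (X i ω))
  have e1 := condExp_mul_of_stronglyMeasurable_left hfX hprod hε
  change ∫ ω, ((f ∘ X i) * fun ω => Y i ω - g (X i ω)) ω ∂μ = 0
  rw [← integral_condExp hm, integral_congr_ae e1]
  refine integral_eq_zero_of_ae ?_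
  filter_upwards [h.error_centered i] with ω hω
  rw [Pi.mul_apply, hω, Pi.zero_apply, mul_zero]

theorem IsRegressionSample.integral_mul_sq_error (h : IsRegressionSample μ X Y g σ) (i : Fin n)
    {f : L2 → ℝ} (hf : Measurable f) (hf0 : ∀ y, 0 ≤ f y) {B : ℝ} (hB : ∀ y, |f y| ≤ B) :
    ∫ ω, f (X i ω) * (Y i ω - g (X i ω)) ^ 2 ∂μ ≤ σ ^ 2 * ∫ ω, f (X i ω) ∂μ := by
  have hm := (h.measurable_X i).comap_le
  have hε : Integrable (fun ω => (Y i ω - g (X i ω)) ^ 2) μ := (h.error_memLp i).integrable_sq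
  have hfX : StronglyMeasurable[MeasurableSpace.comap (X i) inferInstance] (f ∘ X i) :=
    (hf.comp (comap_measurable (X i))).stronglyMeasurable
  have hfm := (hf.comp (h.measurable_X i)).aestronglyMeasurable (μ := μ)
  have hfi : Integrable (f ∘ X i) μ := Integrable.of_bound hfm B (ae_of_all _ fun ω => hB (X i ω))
  have hprod : Integrable ((f ∘ X i) * fun ω => (Y i ω - g (X i ω)) ^ 2) μ :=
    hε.bdd_mul hfm (ae_of_all _ fun ω => hB (X i ω))
  have e1 := condExp_mul_of_stronglyMeasurable_left hfX hprod hε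
  change ∫ ω, ((f ∘ X i) * fun ω => (Y i ω - g (X i ω)) ^ 2) ω ∂μ ≤ _
  rw [← integral_condExp hm, ← integral_const_mul]
  refine integral_mono_ae integrable_condExp (hfi.const_mul _) ?_
  filter_upwards [e1, h.error_condVar i] with ω h1 h2
  rw [h1, Pi.mul_apply, Function.comp_apply, mul_comm]
  exact mul_le_mul_of_nonneg_right h2 (hf0 _)

theorem measurable_replace {m S : Type*} [DecidableEq m] [MeasurableSpace S] (z : m → S) (i : m) :
    Measurable fun (y : S) (l : m) => if l = i then y else z l :=
  measurable_pi_iff.mpr fun l => by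
    by_cases hl : l = i
    · simp only [hl, if_true]; exact measurable_id
    · simp only [hl, if_false]; exact measurable_const

/-- Different errors are uncorrelated given the design: `ε_i` is integrated first, with the other
observations frozen. -/
theorem IsRegressionSample.integral_mul_errors_eq_zero (h : IsRegressionSample μ X Y g σ)
    {i j : Fin n} (hij : i ≠ j) {W : (Fin n → L2) → ℝ} (hW : Measurable W) {B : ℝ}
    (hB : ∀ z, |W z| ≤ B) :
    ∫ ω, W (fun l => X l ω) * ((Y i ω - g (X i ω)) * (Y j ω - g (X j ω))) ∂μ = 0 := by
  set F : (Fin n → L2 × ℝ) → ℝ := fun z =>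
    W (fun l => (z l).1) * (((z i).2 - g (z i).1) * ((z j).2 - g (z j).1)) with hFdef
  have he : ∀ l, Measurable fun z : Fin n → L2 × ℝ => (z l).2 - g (z l).1 := fun l =>
    (measurable_pi_apply l).snd.sub (h.measurable_g.comp (measurable_pi_apply l).fst)
  have hF : Measurable F :=
    (hW.comp (measurable_pi_iff.mpr fun l => (measurable_pi_apply l).fst)).mul ((he i).mul (he j))
  refine ((integral_eq_integral_integral_update
    (fun l => (h.measurable_X l).prodMk (h.measurable_Y l)) h.indep i hF
    (h.integrable_mul_errors i j hW hB)).2).trans ?_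
  refine integral_eq_zero_of_ae (ae_of_all _ fun ω => ?_)
  have h1 := h.integral_mul_error i
    (f := fun y => W fun l => if l = i then y else X l ω)
    (hW.comp (measurable_replace _ i)) (fun y => hB _)
  have h2 := congrArg (fun r => r * (Y j ω - g (X j ω))) h1
  simp only [zero_mul, ← integral_mul_const] at h2
  refine Eq.trans (integral_congr_ae (ae_of_all _ fun ω' => ?_)) h2
  simp only [hFdef, if_true, if_neg hij.symm]
  rw [mul_assoc]
  congr 2
  funext l
  by_cases hl : l = i <;> simp [hl]

theorem IsRegressionSample.integral_mul_sq_error_le (h : IsRegressionSample μ X Y g σ)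
    (i : Fin n) {W : (Fin n → L2) → ℝ} (hW : Measurable W) (hW0 : ∀ z, 0 ≤ W z) {B : ℝ}
    (hB : ∀ z, |W z| ≤ B) :
    ∫ ω, W (fun l => X l ω) * ((Y i ω - g (X i ω)) * (Y i ω - g (X i ω))) ∂μ ≤
      σ ^ 2 * ∫ ω, W (fun l => X l ω) ∂μ := by
  set F : (Fin n → L2 × ℝ) → ℝ := fun z =>
    W (fun l => (z l).1) * (((z i).2 - g (z i).1) * ((z i).2 - g (z i).1)) with hFdef
  have he : ∀ l, Measurable fun z : Fin n → L2 × ℝ => (z l).2 - g (z l).1 := fun l =>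
    (measurable_pi_apply l).snd.sub (h.measurable_g.comp (measurable_pi_apply l).fst)
  have hWm : Measurable fun z : Fin n → L2 × ℝ => W fun l => (z l).1 :=
    hW.comp (measurable_pi_iff.mpr fun l => (measurable_pi_apply l).fst)
  have hF : Measurable F := hWm.mul ((he i).mul (he i))
  have hZ : ∀ l, Measurable fun ω => (X l ω, Y l ω) := fun l =>
    (h.measurable_X l).prodMk (h.measurable_Y l)
  have hWi : Integrable (fun ω => W fun l => X l ω) μ :=
    Integrable.of_bound (hW.comp (measurable_pi_iff.mpr h.measurable_X)).aestronglyMeasurable B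
      (ae_of_all _ fun _ => hB _)
  obtain ⟨i1, e1⟩ := integral_eq_integral_integral_update hZ h.indep i hF
    (h.integrable_mul_errors i i hW hB)
  obtain ⟨i2, e2⟩ := integral_eq_integral_integral_update hZ h.indep i hWm hWi
  refine e1.trans_le ?_
  have e2' : ∫ ω, W (fun l => X l ω) ∂μ = _ := e2
  rw [e2', ← integral_const_mul]
  refine integral_mono i1 (i2.const_mul _) fun ω => ?_
  have h1 := h.integral_mul_sq_error i
    (f := fun y => W fun l => if l = i then y else X l ω)
    (hW.comp (measurable_replace _ i)) (fun y => hW0 _) (fun y => hB _)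
  have hsub : ∀ ω', (fun l => (if l = i then (X i ω', Y i ω') else (X l ω, Y l ω)).1) =
      fun l => if l = i then X i ω' else X l ω := fun ω' => by
    funext l
    by_cases hl : l = i <;> simp [hl]
  simp only [hFdef, if_true, hsub, ← sq]
  exact h1

/-- Conditionally on the design, a weighted sum of the errors has variance at most `σ²` times the
sum of the squared weights. -/
theorem IsRegressionSample.integral_sq_sum_error_le (h : IsRegressionSample μ X Y g σ)
    {w : Fin n → (Fin n → L2) → ℝ} (hw : ∀ i, Measurable (w i)) (hB : ∀ i z, |w i z| ≤ 1) :
    Integrable (fun ω => (∑ i, w i (fun l => X l ω) * (Y i ω - g (X i ω))) ^ 2) μ ∧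
    ∫ ω, (∑ i, w i (fun l => X l ω) * (Y i ω - g (X i ω))) ^ 2 ∂μ ≤
      σ ^ 2 * ∫ ω, ∑ i, w i (fun l => X l ω) ^ 2 ∂μ := by
  have hb : ∀ i j z, |w i z * w j z| ≤ 1 := fun i j z => by
    rw [abs_mul]
    exact mul_le_one₀ (hB i z) (abs_nonneg _) (hB j z)
  have hexp : ∀ ω, (∑ i, w i (fun l => X l ω) * (Y i ω - g (X i ω))) ^ 2 =
      ∑ i, ∑ j, (w i (fun l => X l ω) * w j (fun l => X l ω)) *
        ((Y i ω - g (X i ω)) * (Y j ω - g (X j ω))) := fun ω => by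
    rw [sq, Finset.sum_mul_sum]
    exact Finset.sum_congr rfl fun i _ => Finset.sum_congr rfl fun j _ => by ring
  have hi : ∀ i j, Integrable (fun ω => (w i (fun l => X l ω) * w j (fun l => X l ω)) *
        ((Y i ω - g (X i ω)) * (Y j ω - g (X j ω)))) μ := fun i j =>
    h.integrable_mul_errors i j ((hw i).mul (hw j)) (hb i j)
  have hwi : ∀ i, Integrable (fun ω => w i (fun l => X l ω) ^ 2) μ := fun i =>
    Integrable.of_bound
      (((hw i).comp (measurable_pi_iff.mpr h.measurable_X)).pow_const 2).aestronglyMeasurable 1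
      (ae_of_all _ fun ω => by rw [sq]; exact hb i i _)
  simp_rw [hexp]
  refine ⟨integrable_finsetSum _ fun i _ => integrable_finsetSum _ fun j _ => hi i j, ?_⟩
  rw [integral_finsetSum _ fun i _ => integrable_finsetSum _ fun j _ => hi i j,
    integral_finsetSum _ fun i _ => hwi i, Finset.mul_sum]
  refine Finset.sum_le_sum fun i _ => ?_
  rw [integral_finsetSum _ fun j _ => hi i j, Finset.sum_eq_single i]
  · have := h.integral_mul_sq_error_le i ((hw i).mul (hw i)) (fun z => mul_self_nonneg _) (hb i i)
    simpa only [Pi.mul_apply, sq] using this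
  · intro j _ hj
    exact h.integral_mul_errors_eq_zero hj.symm ((hw i).mul (hw j)) (hb i j)
  · intro hi'
    exact absurd (Finset.mem_univ i) hi'

end Noise

/-! ### Truncation of the basis -/

/-- The residual `(y - x) - ∑_{l < J} ⟨y - x, φ_l⟩ φ_l` of the projection on the first `J` basis
vectors. -/
def residual (φ : HilbertBasis ℕ ℝ L2) (x : L2) (J : ℕ) (y : L2) : L2 :=
  (y - x) - ∑ l : Fin J, coords φ x J y l • φ l

theorem continuous_residual (φ : HilbertBasis ℕ ℝ L2) (x : L2) (J : ℕ) :
    Continuous (residual φ x J) := by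
  have := continuous_coords φ x J
  unfold residual
  fun_prop

theorem inner_sum_coords (φ : HilbertBasis ℕ ℝ L2) (x : L2) (J : ℕ) (y : L2) (i : ℕ) :
    inner ℝ (φ i) (∑ l : Fin J, coords φ x J y l • φ l) =
      if i < J then inner ℝ (φ i) (y - x) else 0 := by
  simp only [inner_sum, inner_smul_right, orthonormal_iff_ite.mp φ.orthonormal, mul_ite, mul_one,
    mul_zero]
  split_ifs with h
  · rw [Finset.sum_eq_single ⟨i, h⟩]
    · simp [coords, real_inner_comm]
    · intro l _ hl
      rw [if_neg]
      rintro rfl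
      exact hl rfl
    · simp
  · exact Finset.sum_eq_zero fun l _ => if_neg (by omega)

theorem inner_residual (φ : HilbertBasis ℕ ℝ L2) (x : L2) (J : ℕ) (y : L2) (i : ℕ) :
    inner ℝ (φ i) (residual φ x J y) = if i < J then 0 else inner ℝ (φ i) (y - x) := by
  rw [residual, inner_sub_right, inner_sum_coords]
  split_ifs <;> simp

theorem norm_sum_coords_le (φ : HilbertBasis ℕ ℝ L2) (x : L2) (J : ℕ) (y : L2) :
    ‖∑ l : Fin J, coords φ x J y l • φ l‖ ≤ ‖y - x‖ := by
  have h0 : inner ℝ (∑ l : Fin J, coords φ x J y l • φ l) (residual φ x J y) = (0 : ℝ) := by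
    simp only [sum_inner, inner_smul_left, inner_residual]
    simp
  have h := norm_add_sq_eq_norm_sq_add_norm_sq_real h0
  have e : (∑ l : Fin J, coords φ x J y l • φ l) + residual φ x J y = y - x := by
    rw [residual]; abel
  rw [e] at h
  nlinarith [norm_nonneg (y - x), norm_nonneg (∑ l : Fin J, coords φ x J y l • φ l),
    norm_nonneg (residual φ x J y)]

theorem sum_sq_coords_le (φ : HilbertBasis ℕ ℝ L2) (x : L2) (J : ℕ) (y : L2) :
    ∑ l, coords φ x J y l ^ 2 ≤ ‖y - x‖ ^ 2 := by
  have h : Orthonormal ℝ fun l : Fin J => φ l := φ.orthonormal.comp _ Fin.val_injective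
  have := h.sum_inner_products_le (y - x) (s := Finset.univ)
  simpa [coords, real_inner_comm] using this

theorem ofReal_sq_norm_residual (φ : HilbertBasis ℕ ℝ L2) (x : L2) (J : ℕ) (y : L2) :
    ENNReal.ofReal (‖residual φ x J y‖ ^ 2) =
      ∑' i, ENNReal.ofReal (inner ℝ (φ (J + i)) (y - x) ^ 2) := by
  have h := φ.hasSum_inner_mul_inner (residual φ x J y) (residual φ x J y)
  have e : ∀ i, inner ℝ (residual φ x J y) (φ i) * inner ℝ (φ i) (residual φ x J y) =
      if i < J then 0 else inner ℝ (φ i) (y - x) ^ 2 := fun i => by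
    rw [real_inner_comm, inner_residual]
    split_ifs <;> ring
  simp only [e, real_inner_self_eq_norm_sq] at h
  rw [← hasSum_nat_add_iff' J, Finset.sum_eq_zero
    (fun i hi => if_pos (Finset.mem_range.mp hi)), sub_zero] at h
  have h2 : HasSum (fun i => inner ℝ (φ (J + i)) (y - x) ^ 2) (‖residual φ x J y‖ ^ 2) := by
    have e2 : ∀ i, (if i + J < J then 0 else inner ℝ (φ (i + J)) (y - x) ^ 2) =
        inner ℝ (φ (J + i)) (y - x) ^ 2 := fun i => by rw [if_neg (by omega), add_comm]
    simp only [e2] at h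
    exact h
  rw [← h2.tsum_eq, ENNReal.ofReal_tsum_of_nonneg (fun i => sq_nonneg _) h2.summable]

/-- Under this fact, type class inference finds that `L2` is second countable. -/
instance fact_two_ne_top : Fact ((2 : ℝ≥0∞) ≠ ∞) := ⟨ENNReal.ofNat_ne_top⟩

/-- The quadratic form of `Γ_N`. The Bochner integral which defines `Γ_N` converges, since the
integrand is bounded by `δ²` on the ball. -/
theorem inner_gammaN {Ω : Type*} [MeasurableSpace Ω] {μ : Measure Ω} [IsProbabilityMeasure μ]
    {Z : Ω → L2} (hZ : Measurable Z) (x : L2) (δ : ℝ) (v : L2) :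
    ENNReal.ofReal (inner ℝ v (GammaN μ Z x δ v)) =
      (μ (Z ⁻¹' Metric.ball x δ))⁻¹ *
        ∫⁻ ω in Z ⁻¹' Metric.ball x δ, ENNReal.ofReal (inner ℝ v (Z ω - x) ^ 2) ∂μ := by
  set E := Z ⁻¹' Metric.ball x δ with hEdef
  have hE : MeasurableSet E := hZ measurableSet_ball
  have hmem : ∀ᵐ ω ∂(μ[|E]), ω ∈ E :=
    Measure.ae_smul_measure (ae_restrict_mem hE) _
  have hcont : Continuous fun y : L2 => InnerProductSpace.rankOne ℝ (y - x) (y - x) :=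
    (InnerProductSpace.rankOne ℝ (E := L2) (F := L2)).continuous₂.comp
      (g := Function.uncurry fun a b : L2 => InnerProductSpace.rankOne ℝ a b)
      (f := fun y : L2 => (y - x, y - x)) (by fun_prop)
  have hmeas : AEStronglyMeasurable (fun ω => InnerProductSpace.rankOne ℝ (Z ω - x) (Z ω - x))
      (μ[|E]) := hcont.comp_aestronglyMeasurable hZ.stronglyMeasurable.aestronglyMeasurable
  have hint : Integrable (fun ω => InnerProductSpace.rankOne ℝ (Z ω - x) (Z ω - x)) (μ[|E]) := by
    refine Integrable.of_bound hmeas (δ * δ) ?_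
    filter_upwards [hmem] with ω hω
    have : ‖Z ω - x‖ < δ := by rwa [← dist_eq_norm]
    rw [InnerProductSpace.norm_rankOne]
    exact mul_le_mul this.le this.le (norm_nonneg _) ((norm_nonneg _).trans this.le)
  have e1 : inner ℝ v (GammaN μ Z x δ v) = ∫ ω, inner ℝ v (Z ω - x) ^ 2 ∂(μ[|E]) := by
    have h := ContinuousLinearMap.integral_comp_comm
      ((innerSL ℝ v).comp (ContinuousLinearMap.apply ℝ L2 v)) hint
    refine Eq.trans h.symm (integral_congr_ae (ae_of_all _ fun ω => ?_))
    change inner ℝ v (InnerProductSpace.rankOne ℝ (Z ω - x) (Z ω - x) v) = _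
    rw [InnerProductSpace.inner_right_rankOne_apply, real_inner_comm v]
    exact (sq _).symm
  have hint2 : Integrable (fun ω => inner ℝ v (Z ω - x) ^ 2) (μ[|E]) := by
    have h := ((innerSL ℝ v).comp (ContinuousLinearMap.apply ℝ L2 v)).integrable_comp hint
    refine h.congr (ae_of_all _ fun ω => ?_)
    change inner ℝ v (InnerProductSpace.rankOne ℝ (Z ω - x) (Z ω - x) v) = _
    rw [InnerProductSpace.inner_right_rankOne_apply, real_inner_comm v]
    exact (sq _).symm
  rw [e1, ofReal_integral_eq_lintegral_ofReal hint2 (ae_of_all _ fun ω => sq_nonneg _),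
    ProbabilityTheory.cond,
    lintegral_smul_measure, smul_eq_mul]

/-- The mean squared residual on the ball is the truncation term. -/
theorem setLIntegral_sq_residual {Ω : Type*} [MeasurableSpace Ω] {μ : Measure Ω}
    [IsProbabilityMeasure μ] {Z : Ω → L2} (hZ : Measurable Z) (φ : HilbertBasis ℕ ℝ L2) (x : L2)
    (δ : ℝ) (J : ℕ) (hμ : μ (Z ⁻¹' Metric.ball x δ) ≠ 0) :
    ∫⁻ ω in Z ⁻¹' Metric.ball x δ, ENNReal.ofReal (‖residual φ x J (Z ω)‖ ^ 2) ∂μ =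
      μ (Z ⁻¹' Metric.ball x δ) * truncTerm μ Z φ x δ J := by
  simp_rw [ofReal_sq_norm_residual]
  rw [lintegral_tsum, truncTerm, ← ENNReal.tsum_mul_left]
  · refine tsum_congr fun i => ?_
    rw [inner_gammaN hZ, ← mul_assoc, ENNReal.mul_inv_cancel hμ (measure_ne_top _ _), one_mul]
  · intro i
    have : Continuous fun y : L2 => inner ℝ (φ (J + i)) (y - x) ^ 2 := by fun_prop
    exact (this.measurable.comp hZ).ennreal_ofReal.aemeasurable

/-- The part of the Taylor polynomial which depends on the truncated coordinates. -/
theorem abs_taylor_sub_proj_le {φ : HilbertBasis ℕ ℝ L2} {x : L2} {δ c₃ : ℝ} {J β : ℕ}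
    (G : ∀ m, ContinuousMultilinearMap ℝ (fun _ : Fin m => L2) ℝ)
    (hG : ∑ k ∈ Finset.Icc 1 (β - 1), δ ^ (k - 1) / ((k - 1).factorial : ℝ) * ‖G k‖ ≤ c₃)
    {y : L2} (hy : y ∈ Metric.ball x δ) :
    |∑ m ∈ Finset.range β, G m (fun _ => y - x) / (m.factorial : ℝ) -
      ∑ m ∈ Finset.range β, G m (fun _ => ∑ l : Fin J, coords φ x J y l • φ l) /
        (m.factorial : ℝ)| ≤ c₃ * ‖residual φ x J y‖ := by
  have hδ : ‖y - x‖ ≤ δ := by rw [← dist_eq_norm]; exact (Metric.mem_ball.mp hy).le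
  set P := ∑ l : Fin J, coords φ x J y l • φ l with hP
  have hPn : ‖P‖ ≤ δ := (norm_sum_coords_le φ x J y).trans hδ
  have hterm : ∀ m, |G m (fun _ => y - x) / (m.factorial : ℝ) -
      G m (fun _ => P) / (m.factorial : ℝ)| ≤
      if m = 0 then 0 else
        δ ^ (m - 1) / ((m - 1).factorial : ℝ) * ‖G m‖ * ‖residual φ x J y‖ := by
    intro m
    rcases m with _ | m
    · have : (fun _ : Fin 0 => y - x) = fun _ => P := Subsingleton.elim _ _
      simp [this]
    · have h := (G (m + 1)).norm_image_sub_le (fun _ => y - x) (fun _ => P)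
      have e : ((fun _ : Fin (m + 1) => y - x) - fun _ => P) = fun _ => residual φ x J y := rfl
      rw [e, pi_norm_const, pi_norm_const, pi_norm_const, Fintype.card_fin, Nat.add_sub_cancel,
        Real.norm_eq_abs] at h
      rw [← sub_div, abs_div, Nat.abs_cast, if_neg (Nat.succ_ne_zero m), Nat.add_sub_cancel,
        Nat.factorial_succ, div_le_iff₀ (by positivity)]
      refine h.trans ?_
      have hm : max ‖y - x‖ ‖P‖ ^ m ≤ δ ^ m :=
        pow_le_pow_left₀ (le_max_of_le_left (norm_nonneg _)) (max_le hδ hPn) m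
      have hf : (0 : ℝ) < (m.factorial : ℝ) := by positivity
      calc ‖G (m + 1)‖ * ((m + 1 : ℕ) : ℝ) * max ‖y - x‖ ‖P‖ ^ m * ‖residual φ x J y‖
          ≤ ‖G (m + 1)‖ * ((m + 1 : ℕ) : ℝ) * δ ^ m * ‖residual φ x J y‖ := by gcongr
        _ = _ := by push_cast; field_simp
  rw [← Finset.sum_sub_distrib]
  refine (Finset.abs_sum_le_sum_abs _ _).trans ((Finset.sum_le_sum fun m _ => hterm m).trans ?_)
  have hre : ∑ m ∈ Finset.range β, (if m = 0 then 0 else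
        δ ^ (m - 1) / ((m - 1).factorial : ℝ) * ‖G m‖ * ‖residual φ x J y‖) =
      (∑ k ∈ Finset.Icc 1 (β - 1), δ ^ (k - 1) / ((k - 1).factorial : ℝ) * ‖G k‖) *
        ‖residual φ x J y‖ := by
    rw [Finset.sum_mul]
    symm
    refine (Finset.sum_congr rfl fun m hm => ?_).trans (Finset.sum_subset ?_ ?_)
    · have := (Finset.mem_Icc.mp hm).1
      rw [if_neg (by omega)]
    · intro m hm
      have := Finset.mem_Icc.mp hm
      rw [Finset.mem_range]
      omega
    · intro m hm hm'
      have h1 := Finset.mem_range.mp hm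
      rw [Finset.mem_Icc] at hm'
      rw [if_pos (by omega)]
  rw [hre]
  exact mul_le_mul_of_nonneg_right hG (norm_nonneg _)

/-! ### The deterministic error bound -/

/-- The design vector: the monomials of the local coordinates, cut off outside the ball. -/
def design (φ : HilbertBasis ℕ ℝ L2) (x : L2) (δ : ℝ) (J K : ℕ) (y : L2) : multiIdx J K → ℝ :=
  indN x δ y • monomials K (coords φ x J y)

theorem indN_of_mem {x y : L2} {δ : ℝ} (h : y ∈ Metric.ball x δ) : indN x δ y = 1 :=
  Set.indicator_of_mem h _

theorem indN_of_notMem {x y : L2} {δ : ℝ} (h : y ∉ Metric.ball x δ) : indN x δ y = 0 :=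
  Set.indicator_of_notMem h _

theorem measurable_indN (x : L2) (δ : ℝ) : Measurable (indN x δ) :=
  measurable_const.indicator measurableSet_ball

theorem indN_nonneg (x y : L2) (δ : ℝ) : 0 ≤ indN x δ y :=
  Set.indicator_nonneg (fun _ _ => zero_le_one) y

theorem measurable_design (φ : HilbertBasis ℕ ℝ L2) (x : L2) (δ : ℝ) (J K : ℕ) :
    Measurable (design φ x δ J K) :=
  (measurable_indN x δ).smul ((continuous_monomials K).comp (continuous_coords φ x J)).measurable

theorem design_of_mem {φ : HilbertBasis ℕ ℝ L2} {x y : L2} {δ : ℝ} {J K : ℕ}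
    (h : y ∈ Metric.ball x δ) : design φ x δ J K y = monomials K (coords φ x J y) := by
  rw [design, indN_of_mem h, one_smul]

theorem design_of_notMem {φ : HilbertBasis ℕ ℝ L2} {x y : L2} {δ : ℝ} {J K : ℕ}
    (h : y ∉ Metric.ball x δ) : design φ x δ J K y = 0 := by
  rw [design, indN_of_notMem h, zero_smul]

theorem design_dotProduct_le {δ δ₀ : ℝ} (hδ : 0 < δ) (hδδ₀ : δ ≤ δ₀) (hδ₀ : δ₀ < 1)
    (φ : HilbertBasis ℕ ℝ L2) (x : L2) (J K : ℕ) (y : L2) :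
    design φ x δ J K y ⬝ᵥ ((tikhonovWeight J K)⁻¹ * design φ x δ J K y) ≤ 1 / (1 - δ₀) := by
  by_cases h : y ∈ Metric.ball x δ
  · rw [design_of_mem h]
    refine monomials_dotProduct_le K _ hδ₀ ((sum_sq_coords_le φ x J y).trans ?_)
    rw [Metric.mem_ball, dist_eq_norm] at h
    nlinarith [norm_nonneg (y - x)]
  · rw [design_of_notMem h, zero_dotProduct]
    exact one_div_nonneg.mpr (by linarith)

theorem e0_dotProduct_le (J K : ℕ) :
    e0 J K ⬝ᵥ ((tikhonovWeight J K)⁻¹ * e0 J K) ≤ 1 := by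
  have h := monomials_dotProduct_le (J := J) K 0 zero_lt_one (by simp)
  rwa [monomials_zero, sub_zero, div_one] at h

theorem gramMatrix_add_tikhonov (φ : HilbertBasis ℕ ℝ L2) (x : L2) (δ : ℝ) (J K : ℕ) {n : ℕ}
    (X : Fin n → L2) :
    gramMatrix φ x δ J K X + tikhonov J K =
      ridge (tikhonovWeight J K) (fun j => design φ x δ J K (X j)) Finset.univ := by
  rw [ridge, add_comm]
  congr 1
  ext k k'
  rw [gramMatrix, Matrix.of_apply, Matrix.sum_apply]
  refine Finset.sum_congr rfl fun j _ => ?_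
  rw [Matrix.vecMulVec_apply]
  by_cases h : X j ∈ Metric.ball x δ
  · rw [design_of_mem h, indN_of_mem h, one_mul]
    rfl
  · rw [design_of_notMem h, indN_of_notMem h]
    simp

theorem momentVec_eq (φ : HilbertBasis ℕ ℝ L2) (x : L2) (δ : ℝ) (J K : ℕ) {n : ℕ}
    (X : Fin n → L2) (Y : Fin n → ℝ) :
    momentVec φ x δ J K X Y = ∑ j, Y j • design φ x δ J K (X j) := by
  ext k
  rw [momentVec, Finset.sum_apply]
  refine Finset.sum_congr rfl fun j _ => ?_
  change _ = Y j * (indN x δ (X j) * xi φ x k.1 (X j))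
  ring

/-- The solution `u` of the regularised normal equations for the evaluation at the centre: the
estimator is the sum of the responses with the weights `d_j ⬝ u`. -/
def centreSol (φ : HilbertBasis ℕ ℝ L2) (x : L2) (δ : ℝ) (J K : ℕ) {n : ℕ} (X : Fin n → L2) :
    multiIdx J K → ℝ :=
  ridgeSol (tikhonovWeight J K) (fun j => design φ x δ J K (X j)) Finset.univ (e0 J K)

/-- The deterministic error bound: with the leverage `a = e₀ ⬝ u` of the centre, the squared error
is controlled by the weighted error sum, and by `a` times the Tikhonov norm of the Taylor
polynomial and the squared remainders in the ball. -/
theorem sq_estimator_sub_le (φ : HilbertBasis ℕ ℝ L2) {g : L2 → ℝ} {x : L2} {δ c₃ τ : ℝ}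
    {J K β : ℕ} (hδ : 0 < δ) (hβ : β ≤ K) (hg : FrechetDiffOnBall g x δ β)
    (hG : ∑ k ∈ Finset.Icc 1 (β - 1),
      δ ^ (k - 1) / ((k - 1).factorial : ℝ) * ‖iteratedFDeriv ℝ k g x‖ ≤ c₃)
    (hτ : ∀ y ∈ Metric.ball x δ,
      ‖iteratedFDeriv ℝ β g y‖ * δ ^ β / (β.factorial : ℝ) ≤ √τ) (hτ0 : 0 ≤ τ)
    {n : ℕ} (X : Fin n → L2) (Y : Fin n → ℝ) :
    (estimator φ x δ J K X Y - g x) ^ 2 ≤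
      4 * ((∑ j, (design φ x δ J K (X j) ⬝ᵥ centreSol φ x δ J K X) *
          (Y j - g (X j))) ^ 2 +
        (e0 J K ⬝ᵥ centreSol φ x δ J K X) * (∑ m ∈ Finset.range β,
          (J : ℝ) ^ m / (m.factorial : ℝ) ^ 2 * ‖iteratedFDeriv ℝ m g x‖ ^ 2) +
        (e0 J K ⬝ᵥ centreSol φ x δ J K X) * (2 * τ * ∑ j, indN x δ (X j) +
          2 * c₃ ^ 2 * ∑ j, indN x δ (X j) * ‖residual φ x J (X j)‖ ^ 2) + τ) := by
  set u := centreSol φ x δ J K X with hu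
  have hs := tikhonovWeight_pos J K
  set d : Fin n → multiIdx J K → ℝ := fun j => design φ x δ J K (X j) with hd
  set G := fun m => iteratedFDeriv ℝ m g x with hGdef
  set θ := taylorCoeff (fun l : Fin J => φ l) K β G with hθ
  set a := e0 J K ⬝ᵥ u with ha
  have ha0 : 0 ≤ a := dotProduct_ridgeSol_nonneg hs d Finset.univ (e0 J K)
  have hφ1 : ∀ l : Fin J, ‖φ l‖ ≤ 1 := fun l => (φ.orthonormal.1 l).le
  have htaylor : ∀ y ∈ Metric.ball x δ, |g y - ∑ k ∈ Finset.range β,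
      G k (fun _ => y - x) / (k.factorial : ℝ)| ≤ √τ := by
    intro y hy
    have hpos : 0 < δ ^ β / (β.factorial : ℝ) := by positivity
    have := hg.abs_sub_taylor_le (M := √τ / (δ ^ β / (β.factorial : ℝ))) (fun z hz => by
      rw [le_div_iff₀ hpos, ← mul_div_assoc]
      exact hτ z hz) hy
    rwa [mul_div_assoc, div_mul_cancel₀ _ hpos.ne'] at this
  -- The value of the Taylor polynomial at the centre; for `β = 0` it is `0` instead of `g x`.
  have hcentre : (e0 J K ⬝ᵥ θ - g x) ^ 2 ≤ τ := by
    have h1 := htaylor x (Metric.mem_ball_self hδ)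
    have h2 := monomials_dotProduct_taylorCoeff hβ (fun l : Fin J => φ l) G (0 : Fin J → ℝ)
    rw [monomials_zero] at h2
    simp only [Pi.zero_apply, zero_smul, Finset.sum_const_zero] at h2
    rw [sub_self, abs_sub_comm] at h1
    rw [h2, ← sq_abs, ← Real.sq_sqrt hτ0]
    exact pow_le_pow_left₀ (abs_nonneg _) h1 2
  have hbias : ∀ j, indN x δ (X j) * (g (X j) - d j ⬝ᵥ θ) ^ 2 ≤
      indN x δ (X j) * (2 * τ + 2 * c₃ ^ 2 * ‖residual φ x J (X j)‖ ^ 2) := by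
    intro j
    by_cases h : X j ∈ Metric.ball x δ
    · rw [indN_of_mem h, one_mul, one_mul]
      have h1 := htaylor _ h
      have h2 := abs_taylor_sub_proj_le (φ := φ) (J := J) G hG h
      have h3 := monomials_dotProduct_taylorCoeff hβ (fun l : Fin J => φ l) G
        (coords φ x J (X j))
      have h4 : d j ⬝ᵥ θ = monomials K (coords φ x J (X j)) ⬝ᵥ θ := by
        simp only [hd, design_of_mem h]
      rw [h4, h3]
      set A := ∑ k ∈ Finset.range β, G k (fun _ => X j - x) / (k.factorial : ℝ)
      set B := ∑ m ∈ Finset.range β,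
        G m (fun _ => ∑ l : Fin J, coords φ x J (X j) l • φ l) / (m.factorial : ℝ)
      have h5 : (g (X j) - A) ^ 2 ≤ τ := by
        rw [← sq_abs, ← Real.sq_sqrt hτ0]
        exact pow_le_pow_left₀ (abs_nonneg _) h1 2
      have h6 : (A - B) ^ 2 ≤ c₃ ^ 2 * ‖residual φ x J (X j)‖ ^ 2 := by
        rw [← sq_abs, ← mul_pow]
        exact pow_le_pow_left₀ (abs_nonneg _) h2 2
      nlinarith [sq_nonneg (g (X j) - A - (A - B))]
    · rw [indN_of_notMem h, zero_mul, zero_mul]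
  have hest : estimator φ x δ J K X Y =
      e0 J K ⬝ᵥ θ - u ⬝ᵥ (tikhonovWeight J K * θ) +
        ∑ j, (Y j - d j ⬝ᵥ θ) * (d j ⬝ᵥ u) := by
    rw [estimator, gramMatrix_add_tikhonov, momentVec_eq]
    have := ridge_error hs d Finset.univ (e0 J K) θ (fun j => Y j - d j ⬝ᵥ θ)
    simp only [add_sub_cancel] at this
    exact this
  have hind : ∀ j, d j ⬝ᵥ u = indN x δ (X j) * (d j ⬝ᵥ u) := by
    intro j
    by_cases h : X j ∈ Metric.ball x δ
    · rw [indN_of_mem h, one_mul]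
    · simp only [hd, design_of_notMem h, zero_dotProduct, mul_zero]
  have hsplit : ∑ j, (Y j - d j ⬝ᵥ θ) * (d j ⬝ᵥ u) =
      ∑ j, (d j ⬝ᵥ u) * (Y j - g (X j)) +
        ∑ j, (indN x δ (X j) * (g (X j) - d j ⬝ᵥ θ)) * (d j ⬝ᵥ u) := by
    rw [← Finset.sum_add_distrib]
    refine Finset.sum_congr rfl fun j _ => ?_
    linear_combination (g (X j) - d j ⬝ᵥ θ) * hind j
  have hB : (∑ j, (indN x δ (X j) * (g (X j) - d j ⬝ᵥ θ)) * (d j ⬝ᵥ u)) ^ 2 ≤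
      a * (2 * τ * ∑ j, indN x δ (X j) +
          2 * c₃ ^ 2 * ∑ j, indN x δ (X j) * ‖residual φ x J (X j)‖ ^ 2) := by
    refine (Finset.sum_mul_sq_le_sq_mul_sq _ _ _).trans ?_
    rw [mul_comm]
    refine mul_le_mul (sum_sq_ridgeSol_le hs d Finset.univ (e0 J K)) ?_
      (Finset.sum_nonneg fun j _ => sq_nonneg _) ha0
    rw [Finset.mul_sum, Finset.mul_sum, ← Finset.sum_add_distrib]
    refine Finset.sum_le_sum fun j _ => ?_
    have e1 : (indN x δ (X j) * (g (X j) - d j ⬝ᵥ θ)) ^ 2 =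
        indN x δ (X j) * (g (X j) - d j ⬝ᵥ θ) ^ 2 := by
      by_cases h : X j ∈ Metric.ball x δ
      · rw [indN_of_mem h, one_mul, one_mul]
      · rw [indN_of_notMem h]; ring
    rw [e1]
    refine (hbias j).trans_eq (by ring)
  have hT : (u ⬝ᵥ (tikhonovWeight J K * θ)) ^ 2 ≤ a * (∑ m ∈ Finset.range β,
      (J : ℝ) ^ m / (m.factorial : ℝ) ^ 2 * ‖iteratedFDeriv ℝ m g x‖ ^ 2) :=
    (sq_ridgeSol_weight_le hs d Finset.univ (e0 J K) θ).trans
      (mul_le_mul_of_nonneg_left (taylorCoeff_weight_le hβ hφ1 G) ha0)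
  rw [hest, hsplit]
  set N := ∑ j, (d j ⬝ᵥ u) * (Y j - g (X j))
  set B := ∑ j, (indN x δ (X j) * (g (X j) - d j ⬝ᵥ θ)) * (d j ⬝ᵥ u)
  set P := u ⬝ᵥ (tikhonovWeight J K * θ)
  set L := e0 J K ⬝ᵥ θ - g x with hL
  have e2 : e0 J K ⬝ᵥ θ - P + (N + B) - g x = N + B - P + L := by rw [hL]; ring
  have h4 : (N + B - P + L) ^ 2 ≤ 4 * (N ^ 2 + P ^ 2 + B ^ 2 + L ^ 2) := by
    nlinarith [sq_nonneg (N - B), sq_nonneg (N + P), sq_nonneg (N - L), sq_nonneg (B + P),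
      sq_nonneg (B - L), sq_nonneg (P + L)]
  rw [e2]
  exact h4.trans (by linarith)

/-- Markov's inequality, relative to a bound for the mean which may vanish. -/
theorem measure_lt_le_of_lintegral_le {Ω : Type*} [MeasurableSpace Ω] {μ : Measure Ω} {f : Ω → ℝ}
    (hf : Measurable f) {b r : ℝ} (hb : 0 ≤ b) (hr : 0 < r)
    (h : ∫⁻ ω, ENNReal.ofReal (f ω) ∂μ ≤ ENNReal.ofReal b) :
    μ {ω | r * b < f ω} ≤ ENNReal.ofReal (1 / r) := by
  rcases hb.eq_or_lt with rfl | hb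
  · rw [ENNReal.ofReal_zero, nonpos_iff_eq_zero, lintegral_eq_zero_iff hf.ennreal_ofReal] at h
    have : μ {ω | r * 0 < f ω} = 0 := by
      rw [mul_zero]
      refine measure_mono_null ?_ (ae_iff.mp h)
      intro ω hω
      simpa using hω
    rw [this]
    exact zero_le
  · have hrb : 0 < r * b := mul_pos hr hb
    calc μ {ω | r * b < f ω} ≤ μ {ω | ENNReal.ofReal (r * b) ≤ ENNReal.ofReal (f ω)} :=
          measure_mono fun ω hω => ENNReal.ofReal_le_ofReal (le_of_lt hω)
      _ ≤ (∫⁻ ω, ENNReal.ofReal (f ω) ∂μ) / ENNReal.ofReal (r * b) :=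
          meas_ge_le_lintegral_div hf.ennreal_ofReal.aemeasurable
            (ENNReal.ofReal_pos.mpr hrb).ne' ENNReal.ofReal_ne_top
      _ ≤ ENNReal.ofReal b / ENNReal.ofReal (r * b) := ENNReal.div_le_div_right h _
      _ = ENNReal.ofReal (1 / r) := by
          rw [← ENNReal.ofReal_div_of_pos hrb]
          congr 1
          field_simp

/-! ### The rate -/

section Moments

variable {Ω : Type*} [MeasurableSpace Ω] {μ : Measure Ω} {n : ℕ}
  {X : Fin n → Ω → L2} {Y : Fin n → Ω → ℝ} {g : L2 → ℝ} {σ : ℝ}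

theorem IsRegressionSample.identDistrib_design (h : IsRegressionSample μ X Y g σ) (i j : Fin n) :
    IdentDistrib (X i) (X j) μ μ :=
  (h.identDistrib i j).comp measurable_fst

theorem IsRegressionSample.iIndepFun_design (h : IsRegressionSample μ X Y g σ) :
    iIndepFun X μ :=
  h.indep.comp (fun _ => Prod.fst) fun _ => measurable_fst

/-- The expectation of a sum over the observations in the ball. -/
theorem IsRegressionSample.lintegral_sum_indN_mul (h : IsRegressionSample μ X Y g σ)
    (x : L2) (δ : ℝ) {f : L2 → ℝ} (hf : Measurable f) (hf0 : ∀ y, 0 ≤ f y) (i₀ : Fin n) :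
    ∫⁻ ω, ENNReal.ofReal (∑ j, indN x δ (X j ω) * f (X j ω)) ∂μ =
      n * ∫⁻ ω in X i₀ ⁻¹' Metric.ball x δ, ENNReal.ofReal (f (X i₀ ω)) ∂μ := by
  have hm : Measurable fun y => ENNReal.ofReal (indN x δ y * f y) :=
    ((measurable_indN x δ).mul hf).ennreal_ofReal
  have e1 : ∀ ω, ENNReal.ofReal (∑ j, indN x δ (X j ω) * f (X j ω)) =
      ∑ j, ENNReal.ofReal (indN x δ (X j ω) * f (X j ω)) := fun ω =>
    ENNReal.ofReal_sum_of_nonneg fun j _ => mul_nonneg (indN_nonneg _ _ _) (hf0 _)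
  have e2 : ∀ j, ∫⁻ ω, ENNReal.ofReal (indN x δ (X j ω) * f (X j ω)) ∂μ =
      ∫⁻ ω in X i₀ ⁻¹' Metric.ball x δ, ENNReal.ofReal (f (X i₀ ω)) ∂μ := fun j => by
    refine (((h.identDistrib_design j i₀).comp hm).lintegral_eq).trans ?_
    rw [← lintegral_indicator (h.measurable_X i₀ measurableSet_ball)]
    refine lintegral_congr fun ω => ?_
    by_cases hω : X i₀ ω ∈ Metric.ball x δ
    · rw [Set.indicator_of_mem (by exact hω), Function.comp_apply, indN_of_mem hω, one_mul]
    · rw [Set.indicator_of_notMem (by exact hω), Function.comp_apply, indN_of_notMem hω, zero_mul,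
        ENNReal.ofReal_zero]
  simp_rw [e1]
  rw [lintegral_finsetSum (f := fun j ω => ENNReal.ofReal (indN x δ (X j ω) * f (X j ω))) _
    fun j _ => hm.comp (h.measurable_X j), Finset.sum_congr rfl
    fun j _ => e2 j, Finset.sum_const, Finset.card_univ, Fintype.card_fin, nsmul_eq_mul]

/-- The factor of the rate which depends on the dimension and the degree. -/
def rateFactor (c₁ : ℝ) (J K : ℕ) : ℝ :=
  Real.exp (8 * c₁ * ((K : ℝ) - 1)) * (J : ℝ) ^ ((8 * c₁ + 2) * ((K : ℝ) - 1))

/-- The factor `exp (2 (K - 1) (log J + 4 c₁)) = e ^ (8 c₁ (K - 1)) J ^ (2 (K - 1))` of the small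
ball bound is covered by the rate factor. -/
theorem exp_le_rateFactor {c₁ : ℝ} (hc₁ : 0 < c₁) {J K : ℕ} (hJ : 0 < J) (hK : 0 < K) :
    Real.exp (2 * (K - 1 : ℕ) * (Real.log J + 4 * c₁)) ≤ rateFactor c₁ J K := by
  have hJ' : (1 : ℝ) ≤ J := by exact_mod_cast hJ
  have hK' : (1 : ℝ) ≤ K := by exact_mod_cast hK
  rw [rateFactor, Real.rpow_def_of_pos (by linarith), ← Real.exp_add]
  apply Real.exp_le_exp.mpr
  push_cast [Nat.cast_sub hK]
  have := mul_nonneg (mul_nonneg (Real.log_nonneg hJ') (by linarith : 0 ≤ (K : ℝ) - 1)) hc₁.le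
  nlinarith

theorem one_le_rateFactor {c₁ : ℝ} (hc₁ : 0 < c₁) {J K : ℕ} (hJ : 0 < J) (hK : 0 < K) :
    1 ≤ rateFactor c₁ J K := by
  have hJ' : (1 : ℝ) ≤ J := by exact_mod_cast hJ
  refine le_trans (Real.one_le_exp ?_) (exp_le_rateFactor hc₁ hJ hK)
  have := Real.log_nonneg hJ'
  positivity

variable [IsProbabilityMeasure μ]

/-- The mean leverage of the centre is at most of the order of the rate factor divided by the
expected number of observations in the ball. -/
theorem IsRegressionSample.integral_leverage_centre_le (h : IsRegressionSample μ X Y g σ)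
    {φ : HilbertBasis ℕ ℝ L2} {x : L2} {δ δ₀ c₁ c₂ : ℝ} {J K : ℕ} (hJ : 0 < J) (hK : 0 < K)
    (hδ : 0 < δ) (hδδ₀ : δ ≤ δ₀) (hδ₀ : δ₀ < 1) (hc₁ : 0 < c₁) (hc₂ : 0 < c₂)
    {q : Seminorm ℝ (Fin J → ℝ)} (hq : ∀ v, q v = 0 → v = 0) (i₀ : Fin n)
    (hdens : DensityCondition μ (X i₀) φ x δ q c₁ c₂)
    (hp : 0 < μ.real (X i₀ ⁻¹' Metric.ball x δ)) :
    ∫ ω, e0 J K ⬝ᵥ centreSol φ x δ J K (fun j => X j ω) ∂μ ≤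
      c₂ * (1 + 1 / (1 - δ₀)) * rateFactor c₁ J K /
        (n * μ.real (X i₀ ⁻¹' Metric.ball x δ)) := by
  set p := μ.real (X i₀ ⁻¹' Metric.ball x δ) with hpdef
  set E := Real.exp (2 * (K - 1 : ℕ) * (Real.log J + 4 * c₁)) with hE
  have hE0 : 0 < E := Real.exp_pos _
  set κ := 1 / (1 - δ₀) with hκdef
  have hκ0 : 0 ≤ κ := one_div_nonneg.mpr (by linarith)
  have hn : (0 : ℝ) < n := by
    have := i₀.pos
    exact_mod_cast this
  set γ := E⁻¹ * (p / c₂) with hγ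
  have hγ0 : 0 < γ := by positivity
  have hball : ∀ i (c : multiIdx J K → ℝ), ENNReal.ofReal (γ * (e0 J K ⬝ᵥ c) ^ 2) ≤
      ∫⁻ ω, ENNReal.ofReal ((design φ x δ J K (X i ω) ⬝ᵥ c) ^ 2) ∂μ := by
    intro i c
    have hdot : Measurable fun y => ENNReal.ofReal ((design φ x δ J K y ⬝ᵥ c) ^ 2) := by
      have : Continuous fun v : multiIdx J K → ℝ => v ⬝ᵥ c := by fun_prop
      exact ((this.measurable.comp (measurable_design φ x δ J K)).pow_const 2).ennreal_ofReal
    have e1 : ∫⁻ ω, ENNReal.ofReal ((design φ x δ J K (X i ω) ⬝ᵥ c) ^ 2) ∂μ =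
        ∫⁻ ω in X i₀ ⁻¹' Metric.ball x δ,
          ENNReal.ofReal ((monomials K (coords φ x J (X i₀ ω)) ⬝ᵥ c) ^ 2) ∂μ := by
      refine (((h.identDistrib_design i i₀).comp hdot).lintegral_eq).trans ?_
      rw [← lintegral_indicator (h.measurable_X i₀ measurableSet_ball)]
      refine lintegral_congr fun ω => ?_
      by_cases hω : X i₀ ω ∈ Metric.ball x δ
      · rw [Set.indicator_of_mem (by exact hω), Function.comp_apply, design_of_mem hω]
      · rw [Set.indicator_of_notMem (by exact hω), Function.comp_apply, design_of_notMem hω]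
        simp
    rw [e1]
    refine le_trans (le_of_eq ?_)
      (hdens.le_setLIntegral_sq (h.measurable_X i₀) hq hJ hc₁ c)
    rw [hγ, mul_comm, ENNReal.ofReal_mul (sq_nonneg _), ENNReal.ofReal_mul (by positivity),
      ENNReal.ofReal_div_of_pos hc₂, Real.exp_neg, hpdef, ofReal_measureReal]
  have hmain := integral_leverage_le h.measurable_X h.iIndepFun_design
    (measurable_design φ x δ J K) (tikhonovWeight_pos J K) (e0_dotProduct_le J K)
    (design_dotProduct_le hδ hδδ₀ hδ₀ φ x J K) hκ0 hγ0.le hball Finset.univ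
  rw [Finset.card_univ, Fintype.card_fin] at hmain
  set A := ∫ ω, e0 J K ⬝ᵥ centreSol φ x δ J K (fun j => X j ω) ∂μ with hA
  have hA0 : 0 ≤ A := integral_nonneg fun ω =>
    dotProduct_ridgeSol_nonneg (tikhonovWeight_pos J K) _ _ _
  have hmain' : A * (1 + γ / (1 + κ) * n) ≤ 1 := hmain
  rw [le_div_iff₀ (by positivity)]
  have h1 : A * (γ / (1 + κ) * n) ≤ 1 := by nlinarith
  calc A * (n * p) = A * (γ / (1 + κ) * n) * (c₂ * (1 + κ) * E) := by
        rw [hγ]; field_simp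
    _ ≤ 1 * (c₂ * (1 + κ) * E) := by gcongr
    _ ≤ c₂ * (1 + κ) * rateFactor c₁ J K := by
        rw [one_mul]
        exact mul_le_mul_of_nonneg_left (exp_le_rateFactor hc₁ hJ hK) (by positivity)

theorem measurable_centreSol (φ : HilbertBasis ℕ ℝ L2) (x : L2) (δ : ℝ) (J K n : ℕ) :
    Measurable (centreSol φ x δ J K (n := n)) :=
  (measurable_ridgeSol _ _ _).comp (measurable_pi_iff.mpr fun j =>
    (measurable_design φ x δ J K).comp (measurable_pi_apply j))

theorem leverage_centre_nonneg (φ : HilbertBasis ℕ ℝ L2) (x : L2) (δ : ℝ) (J K : ℕ)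
    (z : Fin n → L2) : 0 ≤ e0 J K ⬝ᵥ centreSol φ x δ J K z :=
  dotProduct_ridgeSol_nonneg (tikhonovWeight_pos J K) _ _ _

theorem leverage_centre_le_one (φ : HilbertBasis ℕ ℝ L2) (x : L2) (δ : ℝ) (J K : ℕ)
    (z : Fin n → L2) : e0 J K ⬝ᵥ centreSol φ x δ J K z ≤ 1 :=
  (dotProduct_ridgeSol_le (tikhonovWeight_pos J K) _ _ _).trans (e0_dotProduct_le J K)

theorem measurable_leverage_centre (φ : HilbertBasis ℕ ℝ L2) (x : L2) (δ : ℝ) (J K n : ℕ) :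
    Measurable fun z : Fin n → L2 => e0 J K ⬝ᵥ centreSol φ x δ J K z := by
  have : Continuous fun v : multiIdx J K → ℝ => e0 J K ⬝ᵥ v := by fun_prop
  exact this.measurable.comp (measurable_centreSol φ x δ J K n)

theorem IsRegressionSample.integrable_leverage_centre (h : IsRegressionSample μ X Y g σ)
    (φ : HilbertBasis ℕ ℝ L2) (x : L2) (δ : ℝ) (J K : ℕ) :
    Integrable (fun ω => e0 J K ⬝ᵥ centreSol φ x δ J K (fun j => X j ω)) μ :=
  Integrable.of_bound ((measurable_leverage_centre φ x δ J K n).comp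
    (measurable_pi_iff.mpr h.measurable_X)).aestronglyMeasurable 1 (ae_of_all _ fun ω => by
      rw [Real.norm_of_nonneg (leverage_centre_nonneg φ x δ J K _)]
      exact leverage_centre_le_one φ x δ J K _)

/-- The stochastic error has mean square at most `σ²` times the mean leverage. -/
theorem IsRegressionSample.integral_sq_noise_le (h : IsRegressionSample μ X Y g σ)
    (φ : HilbertBasis ℕ ℝ L2) (x : L2) (δ : ℝ) (J K : ℕ) :
    Integrable (fun ω => (∑ j, (design φ x δ J K (X j ω) ⬝ᵥ
      centreSol φ x δ J K (fun j => X j ω)) * (Y j ω - g (X j ω))) ^ 2) μ ∧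
    ∫ ω, (∑ j, (design φ x δ J K (X j ω) ⬝ᵥ
      centreSol φ x δ J K (fun j => X j ω)) * (Y j ω - g (X j ω))) ^ 2 ∂μ ≤
      σ ^ 2 * ∫ ω, e0 J K ⬝ᵥ centreSol φ x δ J K (fun j => X j ω) ∂μ := by
  set w : Fin n → (Fin n → L2) → ℝ := fun j z =>
    design φ x δ J K (z j) ⬝ᵥ centreSol φ x δ J K z with hw
  have hdot : Measurable fun v : (multiIdx J K → ℝ) × (multiIdx J K → ℝ) => v.1 ⬝ᵥ v.2 :=
    (continuous_fst.dotProduct continuous_snd).measurable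
  have hwm : ∀ j, Measurable (w j) := fun j => hdot.comp
    (((measurable_design φ x δ J K).comp (measurable_pi_apply j)).prodMk
      (measurable_centreSol φ x δ J K n))
  have hsum : ∀ z, ∑ j, w j z ^ 2 ≤ e0 J K ⬝ᵥ centreSol φ x δ J K z := fun z =>
    sum_sq_ridgeSol_le (tikhonovWeight_pos J K) (fun j => design φ x δ J K (z j)) Finset.univ
      (e0 J K)
  have hwb : ∀ j z, |w j z| ≤ 1 := fun j z => by
    rw [← sq_le_one_iff_abs_le_one]
    exact (Finset.single_le_sum (fun i _ => sq_nonneg (w i z)) (Finset.mem_univ j)).trans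
      ((hsum z).trans (leverage_centre_le_one φ x δ J K z))
  obtain ⟨h1, h2⟩ := h.integral_sq_sum_error_le hwm hwb
  refine ⟨h1, h2.trans (mul_le_mul_of_nonneg_left ?_ (sq_nonneg σ))⟩
  refine integral_mono_of_nonneg (ae_of_all _ fun ω => Finset.sum_nonneg fun j _ => sq_nonneg _)
    (h.integrable_leverage_centre φ x δ J K) (ae_of_all _ fun ω => hsum _)

end Moments

/-! ### Error bound in probability -/

/-- Markov's inequality for the four random quantities of the deterministic error bound: the
stochastic error, the leverage `a` of the centre (with mean at most `A`), the number of
observations in the ball, and their squared residuals. -/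
theorem IsRegressionSample.measure_lt_sq_error_le {Ω : Type*} [MeasurableSpace Ω] {μ : Measure Ω}
    [IsProbabilityMeasure μ] {n : ℕ} {X : Fin n → Ω → L2} {Y : Fin n → Ω → ℝ} {g : L2 → ℝ}
    {σ : ℝ} (h : IsRegressionSample μ X Y g σ) (φ : HilbertBasis ℕ ℝ L2) {x : L2}
    {δ c₃ τ A t r : ℝ} {J K β : ℕ} (hδ : 0 < δ) (hβ : β ≤ K) (hg : FrechetDiffOnBall g x δ β)
    (hG : ∑ k ∈ Finset.Icc 1 (β - 1),
      δ ^ (k - 1) / ((k - 1).factorial : ℝ) * ‖iteratedFDeriv ℝ k g x‖ ≤ c₃)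
    (hτ : ∀ y ∈ Metric.ball x δ,
      ‖iteratedFDeriv ℝ β g y‖ * δ ^ β / (β.factorial : ℝ) ≤ √τ) (hτ0 : 0 ≤ τ) (i₀ : Fin n)
    (hA : ∫ ω, e0 J K ⬝ᵥ centreSol φ x δ J K (fun j => X j ω) ∂μ ≤ A) (ht : 0 ≤ t)
    (hres : ∫⁻ ω in X i₀ ⁻¹' Metric.ball x δ, ENNReal.ofReal (‖residual φ x J (X i₀ ω)‖ ^ 2) ∂μ =
      ENNReal.ofReal (μ.real (X i₀ ⁻¹' Metric.ball x δ) * t)) (hr : 0 < r) :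
    μ {ω | 4 * (r * (σ ^ 2 * A) + r * A * (∑ m ∈ Finset.range β,
          (J : ℝ) ^ m / (m.factorial : ℝ) ^ 2 * ‖iteratedFDeriv ℝ m g x‖ ^ 2) +
        r * A * (2 * τ * (r * (n * μ.real (X i₀ ⁻¹' Metric.ball x δ))) +
          2 * c₃ ^ 2 * (r * (n * (μ.real (X i₀ ⁻¹' Metric.ball x δ) * t)))) + τ) <
        (estimator φ x δ J K (fun j => X j ω) (fun j => Y j ω) - g x) ^ 2} ≤
      ENNReal.ofReal (4 / r) := by
  set p := μ.real (X i₀ ⁻¹' Metric.ball x δ) with hp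
  set D := ∑ m ∈ Finset.range β,
    (J : ℝ) ^ m / (m.factorial : ℝ) ^ 2 * ‖iteratedFDeriv ℝ m g x‖ ^ 2 with hD
  have hD0 : 0 ≤ D := Finset.sum_nonneg fun k _ => by positivity
  have hp0 : 0 ≤ p := measureReal_nonneg
  have hXm : Measurable fun ω j => X j ω := measurable_pi_iff.mpr h.measurable_X
  set a : Ω → ℝ := fun ω => e0 J K ⬝ᵥ centreSol φ x δ J K (fun j => X j ω) with ha
  have ham : Measurable a := (measurable_leverage_centre φ x δ J K n).comp hXm
  have ha0 : ∀ ω, 0 ≤ a ω := fun ω => leverage_centre_nonneg φ x δ J K _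
  have hA0 : 0 ≤ A := (integral_nonneg ha0).trans hA
  set N : Ω → ℝ := fun ω => ∑ j, (design φ x δ J K (X j ω) ⬝ᵥ
    centreSol φ x δ J K (fun j => X j ω)) * (Y j ω - g (X j ω)) with hN
  have hNm : Measurable N := by
    refine Finset.measurable_sum _ fun j _ => Measurable.mul ?_
      ((h.measurable_Y j).sub (h.measurable_g.comp (h.measurable_X j)))
    have hdot : Measurable fun v : (multiIdx J K → ℝ) × (multiIdx J K → ℝ) => v.1 ⬝ᵥ v.2 :=
      (continuous_fst.dotProduct continuous_snd).measurable
    exact hdot.comp (((measurable_design φ x δ J K).comp (h.measurable_X j)).prodMk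
      ((measurable_centreSol φ x δ J K n).comp hXm))
  set S : Ω → ℝ := fun ω => ∑ j, indN x δ (X j ω) with hS
  set Q : Ω → ℝ := fun ω => ∑ j, indN x δ (X j ω) * ‖residual φ x J (X j ω)‖ ^ 2 with hQ
  have hrm : Measurable fun y => ‖residual φ x J y‖ ^ 2 :=
    ((continuous_residual φ x J).norm.pow 2).measurable
  have hSm : Measurable S :=
    Finset.measurable_sum _ fun j _ => (measurable_indN x δ).comp (h.measurable_X j)
  have hQm : Measurable Q := Finset.measurable_sum _ fun j _ =>
    ((measurable_indN x δ).comp (h.measurable_X j)).mul (hrm.comp (h.measurable_X j))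
  have m1 : μ {ω | r * (σ ^ 2 * A) < N ω ^ 2} ≤ ENNReal.ofReal (1 / r) := by
    refine measure_lt_le_of_lintegral_le (hNm.pow_const 2) (by positivity) hr ?_
    obtain ⟨h1, h2⟩ := h.integral_sq_noise_le φ x δ J K
    rw [← ofReal_integral_eq_lintegral_ofReal h1 (ae_of_all _ fun ω => sq_nonneg _)]
    exact ENNReal.ofReal_le_ofReal (h2.trans (mul_le_mul_of_nonneg_left hA (sq_nonneg σ)))
  have m2 : μ {ω | r * A < a ω} ≤ ENNReal.ofReal (1 / r) := by
    refine measure_lt_le_of_lintegral_le ham hA0 hr ?_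
    rw [← ofReal_integral_eq_lintegral_ofReal (h.integrable_leverage_centre φ x δ J K)
      (ae_of_all _ ha0)]
    exact ENNReal.ofReal_le_ofReal hA
  have m3 : μ {ω | r * (n * p) < S ω} ≤ ENNReal.ofReal (1 / r) := by
    refine measure_lt_le_of_lintegral_le hSm (by positivity) hr ?_
    have h1 := h.lintegral_sum_indN_mul x δ (f := fun _ => 1) measurable_const
      (fun _ => zero_le_one) i₀
    simp only [mul_one, ENNReal.ofReal_one, lintegral_one, Measure.restrict_apply_univ] at h1
    rw [h1, ENNReal.ofReal_mul (Nat.cast_nonneg n), ENNReal.ofReal_natCast, hp,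
      ofReal_measureReal]
  have m4 : μ {ω | r * (n * (p * t)) < Q ω} ≤ ENNReal.ofReal (1 / r) := by
    refine measure_lt_le_of_lintegral_le hQm (by positivity) hr ?_
    have h1 := h.lintegral_sum_indN_mul x δ hrm (fun _ => sq_nonneg _) i₀
    rw [h1, hres, ENNReal.ofReal_mul (Nat.cast_nonneg n), ENNReal.ofReal_natCast]
  have hsub : {ω | 4 * (r * (σ ^ 2 * A) + r * A * D +
        r * A * (2 * τ * (r * (n * p)) + 2 * c₃ ^ 2 * (r * (n * (p * t)))) + τ) <
        (estimator φ x δ J K (fun j => X j ω) (fun j => Y j ω) - g x) ^ 2} ⊆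
      {ω | r * (σ ^ 2 * A) < N ω ^ 2} ∪ {ω | r * A < a ω} ∪
        ({ω | r * (n * p) < S ω} ∪ {ω | r * (n * (p * t)) < Q ω}) := by
    intro ω hω
    by_contra hcon
    simp only [Set.mem_union, Set.mem_ofPred_eq, not_or, not_lt] at hcon
    obtain ⟨⟨k1, k2⟩, k3, k4⟩ := hcon
    have hdet := sq_estimator_sub_le (J := J) φ hδ hβ hg hG hτ hτ0 (fun j => X j ω)
      (fun j => Y j ω)
    have hdet' : _ ≤ 4 * (N ω ^ 2 + a ω * D +
      a ω * (2 * τ * S ω + 2 * c₃ ^ 2 * Q ω) + τ) := hdet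
    have k5 : a ω * D ≤ r * A * D := mul_le_mul_of_nonneg_right k2 hD0
    have hSQ0 : 0 ≤ 2 * τ * S ω + 2 * c₃ ^ 2 * Q ω := by
      have : 0 ≤ S ω := Finset.sum_nonneg fun j _ => indN_nonneg _ _ _
      have : 0 ≤ Q ω := Finset.sum_nonneg fun j _ => mul_nonneg (indN_nonneg _ _ _) (sq_nonneg _)
      positivity
    have k6 : a ω * (2 * τ * S ω + 2 * c₃ ^ 2 * Q ω) ≤
        r * A * (2 * τ * (r * (n * p)) + 2 * c₃ ^ 2 * (r * (n * (p * t)))) := by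
      refine mul_le_mul k2 ?_ hSQ0 (by positivity)
      gcongr
    rw [Set.mem_ofPred_eq] at hω
    linarith
  have hfour : ENNReal.ofReal (4 / r) = ENNReal.ofReal (1 / r) + ENNReal.ofReal (1 / r) +
      (ENNReal.ofReal (1 / r) + ENNReal.ofReal (1 / r)) := by
    have : 0 ≤ 1 / r := by positivity
    rw [← ENNReal.ofReal_add this this, ← ENNReal.ofReal_add (by positivity) (by positivity)]
    congr 1
    ring
  rw [hfour]
  refine (measure_mono hsub).trans ((measure_union_le _ _).trans (add_le_add ?_ ?_))
  · exact (measure_union_le _ _).trans (add_le_add m1 m2)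
  · exact (measure_union_le _ _).trans (add_le_add m3 m4)

/-- A finite Taylor term bounds the highest derivative on the ball. -/
theorem norm_iteratedFDeriv_le_of_taylorTerm {g : L2 → ℝ} {x : L2} {δ : ℝ} {β : ℕ} (hδ : 0 < δ)
    (h : taylorTerm g x δ β ≠ ∞) {y : L2} (hy : y ∈ Metric.ball x δ) :
    ‖iteratedFDeriv ℝ β g y‖ * δ ^ β / (β.factorial : ℝ) ≤ √(taylorTerm g x δ β).toReal := by
  apply Real.le_sqrt_of_sq_le
  rw [← ENNReal.ofReal_le_iff_le_toReal h, taylorTerm]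
  have e : (‖iteratedFDeriv ℝ β g y‖ * δ ^ β / (β.factorial : ℝ)) ^ 2 =
      δ ^ (2 * β) / (β.factorial : ℝ) ^ 2 * ‖iteratedFDeriv ℝ β g y‖ ^ 2 := by
    rw [mul_comm 2 β, pow_mul]; ring
  rw [e, ENNReal.ofReal_mul (by positivity), ENNReal.ofReal_pow (norm_nonneg _), ofReal_norm]
  gcongr
  exact le_iSup₂ (f := fun y (_ : y ∈ Metric.ball x δ) => ‖iteratedFDeriv ℝ β g y‖ₑ ^ 2) y hy

/-- With a leverage of mean at most `A = C₀ ρ / m`, where `m = n p` is the expected number of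
observations in the ball, the error terms add up to a multiple of `ρ`; the bare `τ` is covered
since `1 ≤ ρ`. -/
theorem error_terms_le_rate {r C₀ ρ n p s D τ t c : ℝ} (hr : 0 ≤ r) (hC₀ : 0 ≤ C₀) (hρ : 1 ≤ ρ)
    (hm : 0 < n * p) (hs : 0 ≤ s + D) (hτ : 0 ≤ τ) (ht : 0 ≤ t) :
    4 * (r * (s * (C₀ * ρ / (n * p))) + r * (C₀ * ρ / (n * p)) * D +
      r * (C₀ * ρ / (n * p)) * (2 * τ * (r * (n * p)) + 2 * c ^ 2 * (r * (n * (p * t)))) + τ) ≤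
      4 * (r * C₀ + 2 * r ^ 2 * C₀ * (1 + c ^ 2) + 1) * (ρ * ((s + D) / (n * p) + τ + t)) := by
  set v := (s + D) / (n * p) with hv
  have hv0 : 0 ≤ v := div_nonneg hs hm.le
  set A := C₀ * ρ / (n * p) with hA
  have hAV : A * (s + D) = C₀ * ρ * v := by rw [hA, hv]; ring
  have hAnp : A * (n * p) = C₀ * ρ := by rw [hA]; exact div_mul_cancel₀ _ hm.ne'
  have e1 : 4 * (r * (s * A) + r * A * D +
      r * A * (2 * τ * (r * (n * p)) + 2 * c ^ 2 * (r * (n * (p * t)))) + τ) =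
      4 * (r * C₀ * (ρ * v) + 2 * r ^ 2 * C₀ * (ρ * (τ + c ^ 2 * t)) + τ) := by
    linear_combination 4 * r * hAV + 8 * r ^ 2 * (τ + c ^ 2 * t) * hAnp
  rw [e1]
  have hρ0 : 0 ≤ ρ := zero_le_one.trans hρ
  have t1 : r * C₀ * (ρ * v) ≤ r * C₀ * (ρ * (v + τ + t)) := by
    gcongr
    linarith
  have t2 : 2 * r ^ 2 * C₀ * (ρ * (τ + c ^ 2 * t)) ≤
      2 * r ^ 2 * C₀ * (ρ * ((1 + c ^ 2) * (v + τ + t))) := by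
    gcongr
    nlinarith [mul_nonneg (sq_nonneg c) (add_nonneg hv0 hτ)]
  have t3 : τ ≤ ρ * (v + τ + t) := by nlinarith [mul_nonneg hρ0 hv0, mul_nonneg hρ0 ht]
  linarith

end FLP

end

theorem theorem1 (c₁ c₂ c₃ δ₀ : ℝ) (hc₁ : 0 < c₁) (hc₂ : 0 < c₂) (hc₃ : 0 < c₃) (hδ₀ : δ₀ < 1) :
    ∀ η : ℝ, 0 < η → ∃ C : ℝ, 0 < C ∧
      ∀ (n J K β : ℕ) (hn : 0 < n) (_ : 0 < J) (_ : 0 < K) (_ : β ≤ K)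
        (δ σ : ℝ) (_ : 0 < δ) (_ : δ ≤ δ₀) (_ : 0 < σ)
        (x : FLP.L2) (φ : HilbertBasis ℕ ℝ FLP.L2)
        (q : Seminorm ℝ (Fin J → ℝ)) (_ : ∀ v, q v = 0 → v = 0)
        (Ω : Type*) [MeasurableSpace Ω] (μ : Measure Ω) [IsProbabilityMeasure μ]
        (X : Fin n → Ω → FLP.L2) (Y : Fin n → Ω → ℝ) (g : FLP.L2 → ℝ),
        FLP.IsRegressionSample μ X Y g σ →
        FLP.DensityCondition μ (X ⟨0, hn⟩) φ x δ q c₁ c₂ →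
        FLP.FrechetDiffOnBall g x δ β →
        ∑ k ∈ Finset.Icc 1 (β - 1),
          δ ^ (k - 1) / ((k - 1).factorial : ℝ) * ‖iteratedFDeriv ℝ k g x‖ ≤ c₃ →
        μ {ω | ENNReal.ofReal C * FLP.rate μ (X ⟨0, hn⟩) φ g x δ σ c₁ n J K β <
            ENNReal.ofReal
              (|FLP.estimator φ x δ J K (fun j => X j ω) (fun j => Y j ω) - g x| ^ 2)}
          ≤ ENNReal.ofReal η := by
  intro η hη
  have hκ : 0 < 1 / (1 - δ₀) := one_div_pos.mpr (by linarith)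
  set C₀ : ℝ := c₂ * (1 + 1 / (1 - δ₀)) with hC₀
  have hC₀pos : 0 < C₀ := by positivity
  set r : ℝ := 4 / η with hr
  have hrpos : 0 < r := by positivity
  refine ⟨4 * (r * C₀ + 2 * r ^ 2 * C₀ * (1 + c₃ ^ 2) + 1), by positivity, ?_⟩
  intro n J K β hn hJ hK hβ δ σ hδ hδδ₀ hσ x φ q hq Ω _ μ _ X Y g hsample hdens hg hG
  set C : ℝ := 4 * (r * C₀ + 2 * r ^ 2 * C₀ * (1 + c₃ ^ 2) + 1) with hC
  have hCpos : 0 < C := by positivity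
  set Z := X ⟨0, hn⟩ with hZ
  set E := Z ⁻¹' Metric.ball x δ with hE
  set ρ := FLP.rateFactor c₁ J K with hρ
  have hρ1 : 1 ≤ ρ := FLP.one_le_rateFactor hc₁ hJ hK
  -- If the rate is infinite, there is nothing to prove.
  by_cases hrate : FLP.rate μ Z φ g x δ σ c₁ n J K β = ∞
  · have : {ω | ENNReal.ofReal C * FLP.rate μ Z φ g x δ σ c₁ n J K β <
        ENNReal.ofReal (|FLP.estimator φ x δ J K (fun j => X j ω) (fun j => Y j ω) - g x| ^ 2)} =
        ∅ := by
      rw [hrate, ENNReal.mul_top (ENNReal.ofReal_pos.mpr hCpos).ne']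
      ext ω
      simp
    rw [this, measure_empty]
    exact zero_le
  have hρne : ENNReal.ofReal ρ ≠ 0 := (ENNReal.ofReal_pos.mpr (by linarith)).ne'
  have hparts : FLP.varTerm μ Z g x δ σ n J β + FLP.taylorTerm g x δ β +
      FLP.truncTerm μ Z φ x δ J ≠ ∞ := fun h => hrate (by
    rw [FLP.rate, h]; exact ENNReal.mul_top hρne)
  obtain ⟨h12, htr⟩ := ENNReal.add_ne_top.mp hparts
  obtain ⟨hvar, htay⟩ := ENNReal.add_ne_top.mp h12
  set τ := (FLP.taylorTerm g x δ β).toReal with hτ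
  set tr := (FLP.truncTerm μ Z φ x δ J).toReal with htrdef
  have hτ0 : 0 ≤ τ := ENNReal.toReal_nonneg
  have htr0 : 0 ≤ tr := ENNReal.toReal_nonneg
  set D := ∑ k ∈ Finset.range β, (J : ℝ) ^ k / (k.factorial : ℝ) ^ 2 *
    ‖iteratedFDeriv ℝ k g x‖ ^ 2 with hD
  have hD0 : 0 ≤ D := Finset.sum_nonneg fun k _ => by positivity
  set p := μ.real E with hp
  have hpE : μ E ≠ 0 := by
    intro h0
    apply hvar
    have h1 : μ {ω | Z ω ∈ Metric.ball x δ} = 0 := h0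
    rw [FLP.varTerm, h1, mul_zero]
    exact ENNReal.div_zero (ENNReal.ofReal_pos.mpr (by positivity)).ne'
  have hp0 : 0 < p := ENNReal.toReal_pos hpE (measure_ne_top _ _)
  have hμE : μ E = ENNReal.ofReal p := (ofReal_measureReal).symm
  have hn' : (0 : ℝ) < n := by exact_mod_cast hn
  have hrate_eq : FLP.rate μ Z φ g x δ σ c₁ n J K β =
      ENNReal.ofReal (ρ * ((σ ^ 2 + D) / (n * p) + τ + tr)) := by
    have h1 : FLP.varTerm μ Z g x δ σ n J β = ENNReal.ofReal ((σ ^ 2 + D) / (n * p)) := by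
      have : μ {ω | Z ω ∈ Metric.ball x δ} = ENNReal.ofReal p := hμE
      rw [FLP.varTerm, this, ENNReal.ofReal_div_of_pos (by positivity),
        ENNReal.ofReal_mul hn'.le, ENNReal.ofReal_natCast]
    have h2 : FLP.rate μ Z φ g x δ σ c₁ n J K β = ENNReal.ofReal ρ *
        (FLP.varTerm μ Z g x δ σ n J β + FLP.taylorTerm g x δ β + FLP.truncTerm μ Z φ x δ J) := rfl
    rw [h2, h1, ENNReal.ofReal_mul (zero_le_one.trans hρ1),
      ENNReal.ofReal_add (by positivity) htr0, ENNReal.ofReal_add (by positivity) hτ0,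
      ENNReal.ofReal_toReal htay, ENNReal.ofReal_toReal htr]
  have hlev := hsample.integral_leverage_centre_le hJ hK hδ hδδ₀ hδ₀ hc₁ hc₂ hq ⟨0, hn⟩ hdens hp0
  set A := C₀ * ρ / (n * p) with hA
  have hres : ∫⁻ ω in E, ENNReal.ofReal (‖FLP.residual φ x J (Z ω)‖ ^ 2) ∂μ =
      ENNReal.ofReal (p * tr) := by
    rw [FLP.setLIntegral_sq_residual (hsample.measurable_X _) φ x δ J hpE,
      ENNReal.ofReal_mul hp0.le, ENNReal.ofReal_toReal htr, ← hμE]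
  have hmain := hsample.measure_lt_sq_error_le φ hδ hβ hg hG
    (fun y hy => FLP.norm_iteratedFDeriv_le_of_taylorTerm hδ htay hy) hτ0 ⟨0, hn⟩ hlev htr0 hres
    hrpos
  have hη4 : 4 / r = η := by rw [hr]; field_simp
  rw [hη4] at hmain
  refine (measure_mono fun ω hω => ?_).trans hmain
  rw [Set.mem_ofPred_eq, hrate_eq, ← ENNReal.ofReal_mul hCpos.le, sq_abs,
    ENNReal.ofReal_lt_ofReal_iff_of_nonneg (by positivity)] at hω
  exact (FLP.error_terms_le_rate hrpos.le hC₀pos.le hρ1 (mul_pos hn' hp0)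
    (add_nonneg (sq_nonneg σ) hD0) hτ0 htr0).trans_lt hω
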